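/- Let $n \ge 0$ and let $k$ be a field. Let $\mathrm{Cob}(n)$ be the bordism category: its objects are the closed (compact, without boundary, possibly empty or disconnected) smooth oriented $n$-manifolds; a morphism $M \to N$ is a compact smooth oriented $(n+1)$-manifold $B$ with an orientation-preserving identification $\partial B \cong \overline{M} \sqcup N$ (where $\overline{M}$ is $M$ with the opposite orientation), taken up to orientation-preserving diffeomorphism compatible with the boundary identifications; composition is gluing, the identity of $M$ is the cylinder $M \times [0,1]$, and the symmetric monoidal structure is disjoint union, with the empty manifold as unit. Let $Z : \mathrm{Cob}(n) \to \mathrm{Vect}(k)$ be an $(n+1)$-dimensional topological quantum field theory, that is, a monoidal functor (for example a symmetric monoidal one), where $\mathrm{Vect}(k)$ is the category of $k$-vector spaces with the tensor product. Let $M$ be a closed oriented $n$-manifold, and let $\mathrm{ev}_M : M \sqcup \overline{M} \to \varnothing$ be the bordism given by the cylinder $M \times [0,1]$, both of whose ends are regarded as incoming. Then $Z(M)$ is finite-dimensional, and the bilinear pairing $$Z(M) \otimes Z(\overline{M}) \cong Z(M \sqcup \overline{M}) \xrightarrow{Z(\mathrm{ev}_M)} Z(\varnothing) \cong k$$ is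 perfect. In particular $w \mapsto \langle -, w\rangle$ is an isomorphism of $Z(\overline{M})$ onto the dual vector space $Z(M)^\vee$. -/

import Mathlib

open Set Topology CategoryTheory
open scoped Manifold ContDiff

section LinearAlgebra

variable {U U' V V' : Type*} [AddCommGroup U] [Module ℝ U] [AddCommGroup U'] [Module ℝ U']
  [AddCommGroup V] [Module ℝ V] [AddCommGroup V'] [Module ℝ V'] {n : ℕ}

/-- The linear map `A` is an isomorphism that carries the orientation `o` to `o'`. -/
def PreservesOrientation (A : V →ₗ[ℝ] V') (o : Orientation ℝ V (Fin n))
    (o' : Orientation ℝ V' (Fin n)) : Prop :=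
  ∃ e : V ≃ₗ[ℝ] V', (e : V →ₗ[ℝ] V') = A ∧ Orientation.map (Fin n) e o = o'

/-- `U` has dimension `n` and `V` has dimension `n + 1`. The orientation `o'` of `V` is the one given
by the vector `v` followed by the image under `A` of the orientation `o` of `U`: for a volume form
`η` of `V` in the class `o'`, the pullback under `A` of the contraction `η(v, ⋯)` is a volume form
of `U` in the class `o`. (This forces `A` to be injective and `v` to lie outside its range. It makes
sense for `n = 0` too, where an orientation of a point is a sign.) -/
def TransverseOriented (v : V) (A : U →ₗ[ℝ] V) (o : Orientation ℝ U (Fin n))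
    (o' : Orientation ℝ V (Fin (n + 1))) : Prop :=
  ∃ (η : V [⋀^Fin (n + 1)]→ₗ[ℝ] ℝ) (hη : η ≠ 0) (h : (η.curryLeft v).compLinearMap A ≠ 0),
    rayOfNeZero ℝ η hη = o' ∧ rayOfNeZero ℝ ((η.curryLeft v).compLinearMap A) h = o

theorem PreservesOrientation.refl (o : Orientation ℝ V (Fin n)) :
    PreservesOrientation LinearMap.id o o :=
  ⟨LinearEquiv.refl ℝ V, rfl, by simp⟩

theorem Orientation.map_trans_apply (e : V ≃ₗ[ℝ] V') (f : V' ≃ₗ[ℝ] U)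
    (o : Orientation ℝ V (Fin n)) :
    Orientation.map (Fin n) (e.trans f) o
      = Orientation.map (Fin n) f (Orientation.map (Fin n) e o) := by
  induction o using Module.Ray.ind with | h x hx => rfl

theorem PreservesOrientation.comp {A : V →ₗ[ℝ] V'} {B : V' →ₗ[ℝ] U}
    {o : Orientation ℝ V (Fin n)} {o' : Orientation ℝ V' (Fin n)} {o'' : Orientation ℝ U (Fin n)}
    (hB : PreservesOrientation B o' o'') (hA : PreservesOrientation A o o') :
    PreservesOrientation (B ∘ₗ A) o o'' := by
  obtain ⟨e, rfl, rfl⟩ := hA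
  obtain ⟨f, rfl, rfl⟩ := hB
  exact ⟨e.trans f, rfl, Orientation.map_trans_apply e f o⟩

theorem PreservesOrientation.of_comp {A : V →ₗ[ℝ] V'} {B : V' →ₗ[ℝ] U}
    {o : Orientation ℝ V (Fin n)} {o' : Orientation ℝ V' (Fin n)} {o'' : Orientation ℝ U (Fin n)}
    (hA : PreservesOrientation A o o') (hBA : PreservesOrientation (B ∘ₗ A) o o'') :
    PreservesOrientation B o' o'' := by
  obtain ⟨e, rfl, rfl⟩ := hA
  obtain ⟨f, hf, rfl⟩ := hBA
  refine ⟨e.symm.trans f, ?_, ?_⟩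
  · ext x
    have := LinearMap.congr_fun hf (e.symm x)
    simpa using this
  · rw [Orientation.map_trans_apply, ← Orientation.map_symm, Equiv.symm_apply_apply]

theorem PreservesOrientation.of_comp_left {A : V →ₗ[ℝ] V'} {B : V' →ₗ[ℝ] U}
    {o : Orientation ℝ V (Fin n)} {o' : Orientation ℝ V' (Fin n)} {o'' : Orientation ℝ U (Fin n)}
    (hB : PreservesOrientation B o' o'') (hBA : PreservesOrientation (B ∘ₗ A) o o'') :
    PreservesOrientation A o o' := by
  obtain ⟨e, rfl, rfl⟩ := hB
  obtain ⟨f, hf, hf'⟩ := hBA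
  refine ⟨f.trans e.symm, ?_, ?_⟩
  · ext x
    have := LinearMap.congr_fun hf x
    simpa [LinearEquiv.symm_apply_eq] using this
  · rw [Orientation.map_trans_apply, hf', ← Orientation.map_symm, Equiv.symm_apply_apply]

theorem PreservesOrientation.neg {A : V →ₗ[ℝ] V'}
    {o : Orientation ℝ V (Fin n)} {o' : Orientation ℝ V' (Fin n)}
    (hA : PreservesOrientation A o o') : PreservesOrientation A (-o) (-o') := by
  obtain ⟨e, rfl, rfl⟩ := hA
  exact ⟨e, rfl, by simp⟩

theorem TransverseOriented.map {v : V} {A : U →ₗ[ℝ] V} {o : Orientation ℝ U (Fin n)}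
    {o' : Orientation ℝ V (Fin (n + 1))} {o'' : Orientation ℝ V' (Fin (n + 1))}
    {B : V →ₗ[ℝ] V'} (h : TransverseOriented v A o o') (hB : PreservesOrientation B o' o'') :
    TransverseOriented (B v) (B ∘ₗ A) o o'' := by
  obtain ⟨e, rfl, rfl⟩ := hB
  obtain ⟨η, hη, h0, rfl, rfl⟩ := h
  have key : ((η.compLinearMap (e.symm : V' →ₗ[ℝ] V)).curryLeft (e v)).compLinearMap
      ((e : V →ₗ[ℝ] V') ∘ₗ A) = (η.curryLeft v).compLinearMap A := by
    ext w
    simp only [AlternatingMap.compLinearMap_apply, AlternatingMap.curryLeft_apply_apply]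
    congr 1
    ext i
    refine Fin.cases ?_ (fun j => ?_) i <;> simp
  refine ⟨η.compLinearMap (e.symm : V' →ₗ[ℝ] V),
    mt (η.compLinearEquiv_eq_zero_iff e.symm).mp hη, ?_, ?_, ?_⟩
  · change ((η.compLinearMap (e.symm : V' →ₗ[ℝ] V)).curryLeft (e v)).compLinearMap
      ((e : V →ₗ[ℝ] V') ∘ₗ A) ≠ 0
    rw [key]; exact h0
  · rw [Orientation.map_apply]
  · congr 1

theorem TransverseOriented.comp_right {v : V} {A : U →ₗ[ℝ] V} {B : U' →ₗ[ℝ] U}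
    {o : Orientation ℝ U (Fin n)} {o₁ : Orientation ℝ U' (Fin n)}
    {o' : Orientation ℝ V (Fin (n + 1))}
    (h : TransverseOriented v A o o') (hB : PreservesOrientation B o₁ o) :
    TransverseOriented v (A ∘ₗ B) o₁ o' := by
  obtain ⟨e, rfl, rfl⟩ := hB
  obtain ⟨η, hη, h0, rfl, h1⟩ := h
  have h2 : ((η.curryLeft v).compLinearMap A).compLinearMap (e : U' →ₗ[ℝ] U) ≠ 0 :=
    mt (((η.curryLeft v).compLinearMap A).compLinearEquiv_eq_zero_iff e).mp h0
  refine ⟨η, hη, h2, rfl, ?_⟩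
  have h3 := congrArg (Orientation.map (Fin n) e.symm) h1
  rw [← Orientation.map_symm, Equiv.symm_apply_apply, Orientation.map_symm,
    Orientation.map_apply] at h3
  exact h3

theorem PreservesOrientation.symm {e : V ≃ₗ[ℝ] V'} {o : Orientation ℝ V (Fin n)}
    {o' : Orientation ℝ V' (Fin n)}
    (h : PreservesOrientation (e : V →ₗ[ℝ] V') o o') :
    PreservesOrientation (e.symm : V' →ₗ[ℝ] V) o' o := by
  obtain ⟨f, hf, rfl⟩ := h
  obtain rfl : f = e := LinearEquiv.toLinearMap_injective hf
  exact ⟨f.symm, rfl, by rw [← Orientation.map_symm, Equiv.symm_apply_apply]⟩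

theorem TransverseOriented.of_comp_right {v : V} {A : U →ₗ[ℝ] V} {B : U' →ₗ[ℝ] U}
    {o : Orientation ℝ U (Fin n)} {o₁ : Orientation ℝ U' (Fin n)}
    {o' : Orientation ℝ V (Fin (n + 1))}
    (h : TransverseOriented v (A ∘ₗ B) o₁ o') (hB : PreservesOrientation B o₁ o) :
    TransverseOriented v A o o' := by
  obtain ⟨e, rfl, he⟩ := hB
  have h1 := h.comp_right (PreservesOrientation.symm ⟨e, rfl, he⟩)
  have h2 : (A ∘ₗ (e : U' →ₗ[ℝ] U)) ∘ₗ (e.symm : U →ₗ[ℝ] U') = A := by ext; simp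
  rwa [h2] at h1

theorem TransverseOriented.neg {v : V} {A : U →ₗ[ℝ] V} {o : Orientation ℝ U (Fin n)}
    {o' : Orientation ℝ V (Fin (n + 1))} (h : TransverseOriented v A o o') :
    TransverseOriented (-v) A (-o) o' := by
  obtain ⟨η, hη, h0, rfl, rfl⟩ := h
  have key : (η.curryLeft (-v)).compLinearMap A = -((η.curryLeft v).compLinearMap A) := by
    rw [map_neg]; rfl
  refine ⟨η, hη, by rw [key]; exact neg_ne_zero.mpr h0, rfl, ?_⟩
  rw [neg_rayOfNeZero]
  congr 1

theorem TransverseOriented.neg_neg {v : V} {A : U →ₗ[ℝ] V} {o : Orientation ℝ U (Fin n)}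
    {o' : Orientation ℝ V (Fin (n + 1))} (h : TransverseOriented v A o o') :
    TransverseOriented v A (-o) (-o') := by
  obtain ⟨η, hη, h0, rfl, rfl⟩ := h
  have key : ((-η).curryLeft v).compLinearMap A = -((η.curryLeft v).compLinearMap A) := rfl
  refine ⟨-η, neg_ne_zero.mpr hη, by rw [key]; exact neg_ne_zero.mpr h0, ?_, ?_⟩
  · rw [neg_rayOfNeZero]
  · rw [neg_rayOfNeZero]
    congr 1

theorem TransverseOriented.unique [FiniteDimensional ℝ V] (hV : Module.finrank ℝ V = n + 1)
    {v : V} {A : U →ₗ[ℝ] V} {o : Orientation ℝ U (Fin n)}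
    {o₁ o₂ : Orientation ℝ V (Fin (n + 1))} (h₁ : TransverseOriented v A o o₁)
    (h₂ : TransverseOriented v A o o₂) : o₁ = o₂ := by
  by_contra hne
  have h3 : o₁ = -o₂ := (Orientation.ne_iff_eq_neg o₁ o₂ (by simp [hV])).mp hne
  subst h3
  obtain ⟨η, hη, h0, e1, e2⟩ := h₁
  obtain ⟨η', hη', h0', e1', e2'⟩ := h₂.neg_neg
  have h4 := (ray_eq_iff hη hη').mp (e1.trans e1'.symm)
  obtain ⟨c, hc, hc'⟩ := h4.exists_pos_left hη hη'
  have h5 : (η'.curryLeft v).compLinearMap A = c • ((η.curryLeft v).compLinearMap A) := by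
    rw [← hc']; rfl
  have h6 : SameRay ℝ ((η.curryLeft v).compLinearMap A) ((η'.curryLeft v).compLinearMap A) := by
    rw [h5]; exact SameRay.sameRay_pos_smul_right _ hc
  have h7 : o = -o := by rw [← e2', ← e2]; exact (ray_eq_iff h0 h0').mpr h6
  exact Module.Ray.ne_neg_self o h7

theorem exists_transverseOriented [FiniteDimensional ℝ V] [FiniteDimensional ℝ U]
    (hV : Module.finrank ℝ V = n + 1) (hU : Module.finrank ℝ U = n) {v : V} {A : U →ₗ[ℝ] V}
    (hA : Function.Injective A) (hv : v ∉ LinearMap.range A) (o : Orientation ℝ U (Fin n)) :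
    ∃ o' : Orientation ℝ V (Fin (n + 1)), TransverseOriented v A o o' := by
  have b : Module.Basis (Fin n) ℝ U := Module.finBasisOfFinrankEq ℝ U hU
  have bV : Module.Basis (Fin (n + 1)) ℝ V := Module.finBasisOfFinrankEq ℝ V hV
  have hli : LinearIndependent ℝ (Fin.cons v (A ∘ b) : Fin (n + 1) → V) := by
    refine linearIndependent_finCons.mpr ⟨b.linearIndependent.map' A (LinearMap.ker_eq_bot.mpr hA),
      fun h => hv ?_⟩
    refine Submodule.span_le.mpr ?_ h
    rintro _ ⟨i, rfl⟩
    exact ⟨b i, rfl⟩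
  let b' : Module.Basis (Fin (n + 1)) ℝ V :=
    basisOfLinearIndependentOfCardEqFinrank hli (by simp [hV])
  have hη : bV.det ≠ 0 := bV.det_ne_zero
  have h1 : bV.det b' ≠ 0 := (AlternatingMap.map_basis_ne_zero_iff b' bV.det).mpr hη
  have h0 : (bV.det.curryLeft v).compLinearMap A ≠ 0 := by
    intro h
    apply h1
    have h2 := DFunLike.congr_fun h (⇑b)
    rw [coe_basisOfLinearIndependentOfCardEqFinrank]
    simp only [AlternatingMap.compLinearMap_apply, AlternatingMap.curryLeft_apply_apply] at h2
    exact h2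
  rcases Orientation.eq_or_eq_neg o (rayOfNeZero ℝ _ h0) (by simp [hU]) with h | h
  · exact ⟨rayOfNeZero ℝ _ hη, _, hη, h0, rfl, h.symm⟩
  · refine ⟨-rayOfNeZero ℝ _ hη, ?_⟩
    rw [h]
    exact TransverseOriented.neg_neg ⟨_, hη, h0, rfl, rfl⟩

end LinearAlgebra

section Manifold

variable {E : Type*} [NormedAddCommGroup E] [NormedSpace ℝ E] {H : Type*} [TopologicalSpace H]
  {I : ModelWithCorners ℝ E H} {d : ℕ}

variable (I d) in
/-- An orientation of a manifold: a choice of orientation of every tangent space that is constant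
near every point when it is read in a chart at that point. -/
structure ManifoldOrientation (M : Type*) [TopologicalSpace M] [ChartedSpace H M] where
  orientationAt : ∀ x : M, Orientation ℝ (TangentSpace I x) (Fin d)
  locally_constant : ∀ x₀ : M, ∃ o : Orientation ℝ E (Fin d), ∀ᶠ x in 𝓝 x₀,
    PreservesOrientation (V := TangentSpace I x) (V' := E)
      (mfderiv I 𝓘(ℝ, E) (extChartAt I x₀) x).toLinearMap (orientationAt x) o

variable {M : Type*} [TopologicalSpace M] [ChartedSpace H M]
  {M' : Type*} [TopologicalSpace M'] [ChartedSpace H M']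

/-- The derivative of `f` at every point is an isomorphism that preserves the orientations. -/
def OrientationPreserving (oM : ManifoldOrientation I d M) (oM' : ManifoldOrientation I d M')
    (f : M → M') : Prop :=
  ∀ x, PreservesOrientation (mfderiv I I f x).toLinearMap (oM.orientationAt x) (oM'.orientationAt (f x))

namespace ManifoldOrientation

/-- The opposite orientation. -/
noncomputable def opp (o : ManifoldOrientation I d M) : ManifoldOrientation I d M where
  orientationAt x := -o.orientationAt x
  locally_constant x₀ := by
    obtain ⟨o', h⟩ := o.locally_constant x₀
    exact ⟨-o', h.mono fun x hx => hx.neg⟩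

/-- The orientation of the empty manifold. -/
noncomputable def ofIsEmpty [IsEmpty M] : ManifoldOrientation I d M where
  orientationAt x := isEmptyElim x
  locally_constant x := isEmptyElim x

theorem preserves_inl (x : M) (o : Orientation ℝ (TangentSpace I x) (Fin d)) :
    PreservesOrientation (V := TangentSpace I x) (V' := TangentSpace I (Sum.inl x : M ⊕ M'))
      (mfderiv I I (Sum.inl : M → M ⊕ M') x).toLinearMap o o := by
  have h : mfderiv I I (Sum.inl : M → M ⊕ M') x = ContinuousLinearMap.id ℝ (TangentSpace I x) :=
    mfderiv_sumInl (p := Sum.inl x)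
  rw [h]
  exact PreservesOrientation.refl (V := TangentSpace I x) o

theorem preserves_inr (x : M') (o : Orientation ℝ (TangentSpace I x) (Fin d)) :
    PreservesOrientation (V := TangentSpace I x) (V' := TangentSpace I (Sum.inr x : M ⊕ M'))
      (mfderiv I I (Sum.inr : M' → M ⊕ M') x).toLinearMap o o := by
  have h : mfderiv I I (Sum.inr : M' → M ⊕ M') x = ContinuousLinearMap.id ℝ (TangentSpace I x) :=
    mfderiv_sumInr
  rw [h]
  exact PreservesOrientation.refl (V := TangentSpace I x) o

theorem mfderiv_extChartAt_inl [IsManifold I 1 M] [IsManifold I 1 M'] (x₀ x : M)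
    (hx : x ∈ (chartAt H x₀).source) :
    mfderiv I 𝓘(ℝ, E) (extChartAt I x₀) x =
      (mfderiv I 𝓘(ℝ, E) (extChartAt I (Sum.inl x₀ : M ⊕ M')) (Sum.inl x)).comp
        (mfderiv I I (Sum.inl : M → M ⊕ M') x) := by
  have h1 : (extChartAt I x₀ : M → E) = extChartAt I (Sum.inl x₀ : M ⊕ M') ∘ Sum.inl := by
    ext y
    exact extChartAt_inl_apply.symm
  conv_lhs => rw [h1]
  refine mfderiv_comp x (mdifferentiableAt_extChartAt ?_)
    (ContMDiff.inl.mdifferentiableAt (n := 1) one_ne_zero)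
  rw [ChartedSpace.sum_chartAt_inl]
  simpa using hx

theorem mfderiv_extChartAt_inr [IsManifold I 1 M] [IsManifold I 1 M'] (x₀ x : M')
    (hx : x ∈ (chartAt H x₀).source) :
    mfderiv I 𝓘(ℝ, E) (extChartAt I x₀) x =
      (mfderiv I 𝓘(ℝ, E) (extChartAt I (Sum.inr x₀ : M ⊕ M')) (Sum.inr x)).comp
        (mfderiv I I (Sum.inr : M' → M ⊕ M') x) := by
  have h1 : (extChartAt I x₀ : M' → E) = extChartAt I (Sum.inr x₀ : M ⊕ M') ∘ Sum.inr := by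
    ext y
    exact extChartAt_inr_apply.symm
  conv_lhs => rw [h1]
  refine mfderiv_comp x (mdifferentiableAt_extChartAt ?_)
    (ContMDiff.inr.mdifferentiableAt (n := 1) one_ne_zero)
  rw [ChartedSpace.sum_chartAt_inr]
  simpa using hx

/-- The orientation of a disjoint union. -/
noncomputable def sum [IsManifold I 1 M] [IsManifold I 1 M'] (o : ManifoldOrientation I d M)
    (o' : ManifoldOrientation I d M') : ManifoldOrientation I d (M ⊕ M') where
  orientationAt := Sum.rec (fun x => o.orientationAt x) (fun x => o'.orientationAt x)
  locally_constant := by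
    rintro (x₀ | x₀)
    · obtain ⟨o₀, h⟩ := o.locally_constant x₀
      refine ⟨o₀, ?_⟩
      rw [← IsOpenEmbedding.inl.map_nhds_eq, Filter.eventually_map]
      filter_upwards [h, (chartAt H x₀).open_source.mem_nhds (mem_chart_source H x₀)] with x hx hx'
      rw [mfderiv_extChartAt_inl (M' := M') x₀ x hx'] at hx
      exact (preserves_inl x (o.orientationAt x)).of_comp hx
    · obtain ⟨o₀, h⟩ := o'.locally_constant x₀
      refine ⟨o₀, ?_⟩
      rw [← IsOpenEmbedding.inr.map_nhds_eq, Filter.eventually_map]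
      filter_upwards [h, (chartAt H x₀).open_source.mem_nhds (mem_chart_source H x₀)] with x hx hx'
      rw [mfderiv_extChartAt_inr (M := M) x₀ x hx'] at hx
      exact (preserves_inr x (o'.orientationAt x)).of_comp hx

end ManifoldOrientation

namespace OrientationPreserving

variable {M'' : Type*} [TopologicalSpace M''] [ChartedSpace H M'']
  {o : ManifoldOrientation I d M} {o' : ManifoldOrientation I d M'}
  {o'' : ManifoldOrientation I d M''}

theorem id : OrientationPreserving o o (fun x => x) := by
  intro x
  have h : mfderiv I I (fun x : M => x) x = ContinuousLinearMap.id ℝ (TangentSpace I x) :=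
    mfderiv_id
  rw [h]
  exact PreservesOrientation.refl (V := TangentSpace I x) _

theorem comp {f : M → M'} {g : M' → M''} (hg : OrientationPreserving o' o'' g)
    (hf : OrientationPreserving o o' f) (hg' : MDifferentiable I I g)
    (hf' : MDifferentiable I I f) : OrientationPreserving o o'' (g ∘ f) := by
  intro x
  rw [mfderiv_comp x (hg' (f x)) (hf' x), ContinuousLinearMap.toLinearMap_comp]
  exact (hg (f x)).comp (hf x)

theorem inl [IsManifold I 1 M] [IsManifold I 1 M'] :
    OrientationPreserving o (o.sum o') Sum.inl :=
  fun x => ManifoldOrientation.preserves_inl x (o.orientationAt x)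

theorem inr [IsManifold I 1 M] [IsManifold I 1 M'] :
    OrientationPreserving o' (o.sum o') Sum.inr :=
  fun x => ManifoldOrientation.preserves_inr x (o'.orientationAt x)

theorem of_sum [IsManifold I 1 M] [IsManifold I 1 M'] {f : M ⊕ M' → M''}
    (hf : MDifferentiable I I f) (h : OrientationPreserving o o'' (f ∘ Sum.inl))
    (h' : OrientationPreserving o' o'' (f ∘ Sum.inr)) :
    OrientationPreserving (o.sum o') o'' f := by
  rintro (x | x)
  · have h1 := h x
    rw [mfderiv_comp x (hf (Sum.inl x)) (ContMDiff.inl.mdifferentiableAt (n := 1) one_ne_zero),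
      ContinuousLinearMap.toLinearMap_comp] at h1
    exact (inl (o' := o') x).of_comp h1
  · have h1 := h' x
    rw [mfderiv_comp x (hf (Sum.inr x)) (ContMDiff.inr.mdifferentiableAt (n := 1) one_ne_zero),
      ContinuousLinearMap.toLinearMap_comp] at h1
    exact (inr (o := o) x).of_comp h1

theorem of_comp_eq_id {f : M → M'} {g : M' → M} (hf : OrientationPreserving o o' f)
    (hf' : MDifferentiable I I f) (hg' : MDifferentiable I I g) (hfg : f ∘ g = fun x => x) :
    OrientationPreserving o' o g := by
  intro x
  have h2 : OrientationPreserving o' o' (f ∘ g) := hfg ▸ id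
  have h3 := h2 x
  rw [mfderiv_comp x (hf' (g x)) (hg' x), ContinuousLinearMap.toLinearMap_comp] at h3
  exact (hf (g x)).of_comp_left h3

end OrientationPreserving

end Manifold

section Cylinder

/-- The model vector space `ℝⁿ × ℝ` of bordisms between `n`-manifolds. -/
abbrev BordismSpace (n : ℕ) : Type := EuclideanSpace ℝ (Fin n) × EuclideanSpace ℝ (Fin 1)

/-- The half-space `ℝⁿ × [0, ∞)`. -/
abbrev BordismHalfSpace (n : ℕ) : Type := ModelProd (EuclideanSpace ℝ (Fin n)) (EuclideanHalfSpace 1)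

/-- Manifolds modelled on `bordismModel n` are the `(n + 1)`-manifolds with boundary: the model is
the inclusion of the half-space `ℝⁿ × [0, ∞)` in `ℝⁿ × ℝ`. -/
noncomputable abbrev bordismModel (n : ℕ) :
    ModelWithCorners ℝ (BordismSpace n) (BordismHalfSpace n) :=
  (𝓡 n).prod (𝓡∂ 1)

variable {n : ℕ}

/-- The tangent vector `v` at the boundary point `w` points into the manifold: the derivative of
a chart at `w` (that maps the boundary to `ℝⁿ × {0}`) sends `v` into `ℝⁿ × (0, ∞)`. -/
def InwardPointing {W : Type*} [TopologicalSpace W] [ChartedSpace (BordismHalfSpace n) W] (w : W)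
    (v : TangentSpace (bordismModel n) w) : Prop :=
  0 < (show BordismSpace n from
    mfderiv (bordismModel n) 𝓘(ℝ, BordismSpace n) (extChartAt (bordismModel n) w) w v).2 0

theorem unitInterval_mfderiv_extChartAt (t₀ t : unitInterval) :
    (show EuclideanSpace ℝ (Fin 1) from
      mfderiv (𝓡∂ 1) 𝓘(ℝ, EuclideanSpace ℝ (Fin 1)) (extChartAt (𝓡∂ 1) t₀) t
        (oneTangentSpaceIcc t)) =
    (if (t₀ : ℝ) < 1 then (1 : ℝ) else -1) • WithLp.toLp 2 (fun _ => (1 : ℝ)) := by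
  have hone : mfderiv (𝓡∂ 1) 𝓘(ℝ) (Subtype.val : unitInterval → ℝ) t (oneTangentSpaceIcc t)
      = (1 : ℝ) := mfderiv_subtypeVal_Icc_one t
  have hd : MDifferentiableAt (𝓡∂ 1) 𝓘(ℝ) (Subtype.val : unitInterval → ℝ) t :=
    (contMDiff_subtypeVal_Icc (n := 1) (x := 0) (y := 1)).mdifferentiableAt one_ne_zero
  have key : ∀ (c a : ℝ), (fun z : unitInterval =>
        (WithLp.toLp 2 (fun _ => a + c * (z : ℝ)) : EuclideanSpace ℝ (Fin 1)))
        = (fun z => extChartAt (𝓡∂ 1) t₀ z) →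
      (show EuclideanSpace ℝ (Fin 1) from
      mfderiv (𝓡∂ 1) 𝓘(ℝ, EuclideanSpace ℝ (Fin 1)) (extChartAt (𝓡∂ 1) t₀) t
        (oneTangentSpaceIcc t)) = c • WithLp.toLp 2 (fun _ => (1 : ℝ)) := by
    intro c a h
    let L : ℝ → EuclideanSpace ℝ (Fin 1) := fun r =>
      a • WithLp.toLp 2 (fun _ => (1 : ℝ)) + r • (c • WithLp.toLp 2 (fun _ => (1 : ℝ)))
    have hL : HasFDerivAt L ((ContinuousLinearMap.id ℝ ℝ).smulRight
        (c • WithLp.toLp 2 (fun _ => (1 : ℝ)) : EuclideanSpace ℝ (Fin 1))) (t : ℝ) :=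
      ((hasFDerivAt_id (t : ℝ)).smul_const _).const_add _
    have h' : (extChartAt (𝓡∂ 1) t₀ : unitInterval → _) = L ∘ Subtype.val := by
      rw [show (extChartAt (𝓡∂ 1) t₀ : unitInterval → _)
        = (fun z => extChartAt (𝓡∂ 1) t₀ z) from rfl, ← h]
      ext z i
      simp [L, mul_comm]
    have h3 := HasMFDerivAt.comp t hL.hasMFDerivAt hd.hasMFDerivAt
    rw [h', h3.mfderiv]
    change (ContinuousLinearMap.smulRight _ _) (mfderiv (𝓡∂ 1) 𝓘(ℝ)
      (Subtype.val : unitInterval → ℝ) t (oneTangentSpaceIcc t)) = _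
    rw [hone]
    exact one_smul ℝ _
  split_ifs with h
  · refine key 1 0 ?_
    ext z i
    have : chartAt (EuclideanHalfSpace 1) t₀ = IccLeftChart 0 1 := by
      rw [Icc_chartedSpaceChartAt, if_pos h]
    simp only [extChartAt, this]
    simp [IccLeftChart, modelWithCornersEuclideanHalfSpace]
  · refine key (-1) 1 ?_
    ext z i
    have : chartAt (EuclideanHalfSpace 1) t₀ = IccRightChart 0 1 := by
      rw [Icc_chartedSpaceChartAt, if_neg h]
    simp only [extChartAt, this]
    simp [IccRightChart, modelWithCornersEuclideanHalfSpace]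
    ring

variable {M : Type*} [TopologicalSpace M] [ChartedSpace (EuclideanSpace ℝ (Fin n)) M]

/-- The tangent vector `∂/∂t` of the cylinder `M × [0, 1]`. -/
noncomputable def cylinderVector (p : M × unitInterval) : TangentSpace (bordismModel n) p :=
  show EuclideanSpace ℝ (Fin n) × EuclideanSpace ℝ (Fin 1) from (0, oneTangentSpaceIcc p.2)

/-- The inclusion of the tangent space of `M` in the tangent space of the cylinder. -/
noncomputable def cylinderIncl (p : M × unitInterval) :
    TangentSpace (𝓡 n) p.1 →ₗ[ℝ] TangentSpace (bordismModel n) p :=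
  LinearMap.inl ℝ (EuclideanSpace ℝ (Fin n)) (EuclideanSpace ℝ (Fin 1))

theorem mfderiv_cylinderIncl (x : M) (t : unitInterval) :
    (mfderiv (𝓡 n) (bordismModel n) (fun y : M => (y, t)) x).toLinearMap
      = cylinderIncl (n := n) (x, t) := by
  have h : mfderiv (𝓡 n) (bordismModel n) (fun y : M => (y, t)) x =
    ContinuousLinearMap.inl ℝ (TangentSpace (𝓡 n) x) (TangentSpace (𝓡∂ 1) t) :=
    mfderiv_prod_left
  rw [h]
  rfl

theorem mfderiv_cylinder_chart [IsManifold (𝓡 n) 1 M] (p₀ p : M × unitInterval)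
    (h : p.1 ∈ (chartAt (EuclideanSpace ℝ (Fin n)) p₀.1).source)
    (h' : p.2 ∈ (chartAt (EuclideanHalfSpace 1) p₀.2).source) :
    mfderiv (bordismModel n) 𝓘(ℝ, BordismSpace n) (extChartAt (bordismModel n) p₀) p =
      (mfderiv (𝓡 n) 𝓘(ℝ, EuclideanSpace ℝ (Fin n)) (extChartAt (𝓡 n) p₀.1) p.1).prodMap
      (mfderiv (𝓡∂ 1) 𝓘(ℝ, EuclideanSpace ℝ (Fin 1)) (extChartAt (𝓡∂ 1) p₀.2) p.2) := by
  rw [extChartAt_prod]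
  have := mfderiv_prodMap (p := p) (mdifferentiableAt_extChartAt (I := 𝓡 n) h)
    (mdifferentiableAt_extChartAt (I := 𝓡∂ 1) h')
  rw [modelWithCornersSelf_prod, ← chartedSpaceSelf_prod]
  exact this

theorem cylinder_chart_vector (p₀ p : M × unitInterval) [IsManifold (𝓡 n) 1 M]
    (h : p.1 ∈ (chartAt (EuclideanSpace ℝ (Fin n)) p₀.1).source)
    (h' : p.2 ∈ (chartAt (EuclideanHalfSpace 1) p₀.2).source) :
    (show BordismSpace n from mfderiv (bordismModel n) 𝓘(ℝ, BordismSpace n)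
      (extChartAt (bordismModel n) p₀) p (cylinderVector p)) =
    (0, (if (p₀.2 : ℝ) < 1 then (1 : ℝ) else -1) • WithLp.toLp 2 (fun _ => (1 : ℝ))) := by
  rw [mfderiv_cylinder_chart p₀ p h h']
  refine Prod.ext ?_ (unitInterval_mfderiv_extChartAt p₀.2 p.2)
  exact map_zero (mfderiv (𝓡 n) 𝓘(ℝ, EuclideanSpace ℝ (Fin n)) (extChartAt (𝓡 n) p₀.1) p.1)

theorem cylinderVector_zero_inward (x : M) [IsManifold (𝓡 n) 1 M] :
    InwardPointing (n := n) (x, (0 : unitInterval)) (cylinderVector (x, 0)) := by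
  unfold InwardPointing
  rw [cylinder_chart_vector (x, 0) (x, 0) (mem_chart_source _ _) (mem_chart_source _ _)]
  simp

theorem cylinderVector_one_inward (x : M) [IsManifold (𝓡 n) 1 M] :
    InwardPointing (n := n) (x, (1 : unitInterval)) (-cylinderVector (x, 1)) := by
  unfold InwardPointing
  rw [map_neg]
  change 0 < (-(show BordismSpace n from mfderiv (bordismModel n) 𝓘(ℝ, BordismSpace n)
      (extChartAt (bordismModel n) (x, (1 : unitInterval))) (x, 1) (cylinderVector (x, 1)))).2 0
  rw [cylinder_chart_vector (x, 1) (x, 1) (mem_chart_source _ _) (mem_chart_source _ _)]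
  simp

theorem exists_transverseOriented_inl {w : EuclideanSpace ℝ (Fin 1)} (hw : w ≠ 0)
    (o : Orientation ℝ (EuclideanSpace ℝ (Fin n)) (Fin n)) :
    ∃ o' : Orientation ℝ (BordismSpace n) (Fin (n + 1)),
      TransverseOriented ((0, w) : BordismSpace n) (LinearMap.inl ℝ _ _) o o' := by
  refine exists_transverseOriented (by simp) (by simp) LinearMap.inl_injective ?_ o
  rintro ⟨u, hu⟩
  exact hw (congrArg Prod.snd hu).symm

theorem unitInterval_one_ne_zero (t : unitInterval) :
    (show EuclideanSpace ℝ (Fin 1) from oneTangentSpaceIcc t) ≠ 0 := by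
  intro h
  have h1 := unitInterval_mfderiv_extChartAt t t
  have h2 : oneTangentSpaceIcc t = (0 : TangentSpace (𝓡∂ 1) t) := h
  rw [h2, map_zero] at h1
  have h3 := congrArg (fun v : EuclideanSpace ℝ (Fin 1) => v 0) h1
  change (0 : ℝ) = _ at h3
  split_ifs at h3 <;> simp at h3

theorem exists_cylinder_orientation (o : ManifoldOrientation (𝓡 n) n M) (p : M × unitInterval) :
    ∃ o' : Orientation ℝ (TangentSpace (bordismModel n) p) (Fin (n + 1)),
      TransverseOriented (cylinderVector p) (cylinderIncl p) (o.orientationAt p.1) o' :=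
  exists_transverseOriented_inl (unitInterval_one_ne_zero p.2) (o.orientationAt p.1)

/-- The orientation of the cylinder `M × [0, 1]`: `∂/∂t` followed by the orientation of `M`. -/
noncomputable def ManifoldOrientation.cylinder [IsManifold (𝓡 n) 1 M]
    (o : ManifoldOrientation (𝓡 n) n M) :
    ManifoldOrientation (bordismModel n) (n + 1) (M × unitInterval) where
  orientationAt p := (exists_cylinder_orientation o p).choose
  locally_constant p₀ := by
    obtain ⟨o₀, h₀⟩ := o.locally_constant p₀.1
    have hw : ((if (p₀.2 : ℝ) < 1 then (1 : ℝ) else -1) • WithLp.toLp 2 (fun _ => (1 : ℝ)) :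
        EuclideanSpace ℝ (Fin 1)) ≠ 0 := by
      intro h
      have h3 := congrArg (fun v : EuclideanSpace ℝ (Fin 1) => v 0) h
      dsimp at h3
      split_ifs at h3 <;> simp at h3
    obtain ⟨o', h'⟩ := exists_transverseOriented_inl (n := n) hw o₀
    refine ⟨o', ?_⟩
    have e1 := (continuous_fst.continuousAt (x := p₀)).eventually h₀
    have e2 := (continuous_fst.continuousAt (x := p₀)).eventually
      ((chartAt (EuclideanSpace ℝ (Fin n)) p₀.1).open_source.mem_nhds (mem_chart_source _ p₀.1))
    have e3 := (continuous_snd.continuousAt (x := p₀)).eventually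
      ((chartAt (EuclideanHalfSpace 1) p₀.2).open_source.mem_nhds (mem_chart_source _ p₀.2))
    filter_upwards [e1, e2, e3] with p h1 h2 h3
    have hR := (exists_cylinder_orientation o p).choose_spec
    obtain ⟨e, he⟩ := isInvertible_mfderiv_extChartAt (I := bordismModel n) (x := p₀) (y := p)
      (by rw [extChartAt_source]; exact ⟨h2, h3⟩)
    have hP : PreservesOrientation (V := TangentSpace (bordismModel n) p) (V' := BordismSpace n)
        (mfderiv (bordismModel n) 𝓘(ℝ, BordismSpace n)
          (extChartAt (bordismModel n) p₀) p).toLinearMap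
        ((exists_cylinder_orientation o p).choose)
        (Orientation.map (Fin (n + 1)) e.toLinearEquiv
          ((exists_cylinder_orientation o p).choose)) :=
      ⟨e.toLinearEquiv, by rw [← he]; rfl, rfl⟩
    have hR' := hR.map hP
    have hv := cylinder_chart_vector p₀ p h2 h3
    have hA : (mfderiv (bordismModel n) 𝓘(ℝ, BordismSpace n)
          (extChartAt (bordismModel n) p₀) p).toLinearMap ∘ₗ cylinderIncl p
        = (LinearMap.inl ℝ (EuclideanSpace ℝ (Fin n)) (EuclideanSpace ℝ (Fin 1))) ∘ₗ
          (mfderiv (𝓡 n) 𝓘(ℝ, EuclideanSpace ℝ (Fin n))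
            (extChartAt (𝓡 n) p₀.1) p.1).toLinearMap := by
      rw [mfderiv_cylinder_chart p₀ p h2 h3]
      ext u
      refine Prod.ext rfl ?_
      exact map_zero (mfderiv (𝓡∂ 1) 𝓘(ℝ, EuclideanSpace ℝ (Fin 1)) (extChartAt (𝓡∂ 1) p₀.2) p.2)
    have hR2 : TransverseOriented (V := BordismSpace n)
        (0, (if (p₀.2 : ℝ) < 1 then (1 : ℝ) else -1) • WithLp.toLp 2 (fun _ => (1 : ℝ)))
        ((LinearMap.inl ℝ (EuclideanSpace ℝ (Fin n)) (EuclideanSpace ℝ (Fin 1))) ∘ₗ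
          (mfderiv (𝓡 n) 𝓘(ℝ, EuclideanSpace ℝ (Fin n))
            (extChartAt (𝓡 n) p₀.1) p.1).toLinearMap) (o.orientationAt p.1)
        (Orientation.map (Fin (n + 1)) e.toLinearEquiv
          ((exists_cylinder_orientation o p).choose)) := by
      rw [← hv, ← hA]
      exact hR'
    have hR3 := hR2.of_comp_right h1
    rw [hR3.unique (by simp) h'] at hP
    exact hP

theorem ManifoldOrientation.cylinder_transverse [IsManifold (𝓡 n) 1 M]
    (o : ManifoldOrientation (𝓡 n) n M) (p : M × unitInterval) :
    TransverseOriented (cylinderVector p) (cylinderIncl p) (o.orientationAt p.1) (o.cylinder.orientationAt p) :=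
  (exists_cylinder_orientation o p).choose_spec

end Cylinder

universe u v

/-- Closed (compact, boundaryless, Hausdorff) smooth oriented `n`-manifolds, possibly empty or
disconnected. -/
structure ClosedManifold (n : ℕ) : Type (u + 1) where
  carrier : Type u
  [topologicalSpace : TopologicalSpace carrier]
  [chartedSpace : ChartedSpace (EuclideanSpace ℝ (Fin n)) carrier]
  [isManifold : IsManifold (𝓡 n) ∞ carrier]
  [compactSpace : CompactSpace carrier]
  [t2Space : T2Space carrier]
  orientation : ManifoldOrientation (𝓡 n) n carrier

attribute [instance] ClosedManifold.topologicalSpace ClosedManifold.chartedSpace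
  ClosedManifold.isManifold ClosedManifold.compactSpace ClosedManifold.t2Space

namespace ClosedManifold

variable {n : ℕ}

/-- The manifold `M̄`: the same manifold with the opposite orientation. -/
noncomputable def opp (M : ClosedManifold.{u} n) : ClosedManifold.{u} n where
  carrier := M.carrier
  orientation := M.orientation.opp

/-- The disjoint union. -/
noncomputable def sum (M N : ClosedManifold.{u} n) : ClosedManifold.{u} n where
  carrier := M.carrier ⊕ N.carrier
  orientation := M.orientation.sum N.orientation

variable (n) in
/-- The empty `n`-manifold. -/
noncomputable def empty : ClosedManifold.{u} n :=
  letI : ChartedSpace (EuclideanSpace ℝ (Fin n)) PEmpty.{u + 1} := ChartedSpace.empty _ _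
  { carrier := PEmpty.{u + 1}
    isManifold := { compatible := fun he => by cases he }
    orientation := .ofIsEmpty }

instance : IsEmpty (empty.{u} n).carrier := inferInstanceAs (IsEmpty PEmpty)

end ClosedManifold

/-- Orientation preserving diffeomorphisms of closed manifolds. -/
structure OrientedDiffeo {n : ℕ} (M N : ClosedManifold.{u} n) where
  toDiffeo : M.carrier ≃ₘ⟮𝓡 n, 𝓡 n⟯ N.carrier
  oriented : OrientationPreserving M.orientation N.orientation toDiffeo

namespace OrientedDiffeo

variable {n : ℕ} {M N L M' N' : ClosedManifold.{u} n}

theorem ext_of_apply {f g : OrientedDiffeo M N} (h : ∀ x, f.toDiffeo x = g.toDiffeo x) : f = g := by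
  obtain ⟨f, _⟩ := f
  obtain ⟨g, _⟩ := g
  obtain rfl : f = g := Diffeomorph.ext h
  rfl

/-- The identity diffeomorphism. -/
noncomputable def refl (M : ClosedManifold.{u} n) : OrientedDiffeo M M where
  toDiffeo := Diffeomorph.refl _ _ _
  oriented := OrientationPreserving.id

/-- Composition. -/
noncomputable def trans (f : OrientedDiffeo M N) (g : OrientedDiffeo N L) :
    OrientedDiffeo M L where
  toDiffeo := f.toDiffeo.trans g.toDiffeo
  oriented := g.oriented.comp f.oriented (g.toDiffeo.mdifferentiable (by simp))
    (f.toDiffeo.mdifferentiable (by simp))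

/-- Disjoint union. -/
noncomputable def sum (f : OrientedDiffeo M N) (g : OrientedDiffeo M' N') :
    OrientedDiffeo (M.sum M') (N.sum N') where
  toDiffeo := f.toDiffeo.sumCongr g.toDiffeo
  oriented := .of_sum ((f.toDiffeo.sumCongr g.toDiffeo).mdifferentiable (by simp))
    (OrientationPreserving.inl.comp f.oriented (ContMDiff.inl.mdifferentiable (n := 1) one_ne_zero)
      (f.toDiffeo.mdifferentiable (by simp)))
    (OrientationPreserving.inr.comp g.oriented (ContMDiff.inr.mdifferentiable (n := 1) one_ne_zero)
      (g.toDiffeo.mdifferentiable (by simp)))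

/-- The inverse. -/
noncomputable def symm (f : OrientedDiffeo M N) : OrientedDiffeo N M where
  toDiffeo := f.toDiffeo.symm
  oriented := f.oriented.of_comp_eq_id (f.toDiffeo.mdifferentiable (by simp))
    (f.toDiffeo.symm.mdifferentiable (by simp)) (funext f.toDiffeo.apply_symm_apply)

variable (M N L) in
/-- `(M ⊔ N) ⊔ L → M ⊔ (N ⊔ L)`. -/
noncomputable def sumAssoc : OrientedDiffeo ((M.sum N).sum L) (M.sum (N.sum L)) where
  toDiffeo := Diffeomorph.sumAssoc (𝓡 n) M.carrier ∞ N.carrier L.carrier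
  oriented := by
    have hl {X Y : ClosedManifold.{u} n} :
        MDifferentiable (𝓡 n) (𝓡 n) (Sum.inl : X.carrier → X.carrier ⊕ Y.carrier) :=
      ContMDiff.inl.mdifferentiable (n := 1) one_ne_zero
    have hr {X Y : ClosedManifold.{u} n} :
        MDifferentiable (𝓡 n) (𝓡 n) (Sum.inr : Y.carrier → X.carrier ⊕ Y.carrier) :=
      ContMDiff.inr.mdifferentiable (n := 1) one_ne_zero
    have hd := (Diffeomorph.sumAssoc (𝓡 n) M.carrier ∞ N.carrier L.carrier).mdifferentiable
      (by simp)
    exact .of_sum hd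
      (.of_sum (hd.comp (hl (X := M.sum N) (Y := L))) .inl
        (OrientationPreserving.inr.comp .inl (hr (X := M) (Y := N.sum L)) (hl (X := N) (Y := L))))
      (OrientationPreserving.inr.comp .inr (hr (X := M) (Y := N.sum L)) (hr (X := N) (Y := L)))

variable (M N) in
/-- `M ⊔ N → N ⊔ M`. -/
noncomputable def sumComm : OrientedDiffeo (M.sum N) (N.sum M) where
  toDiffeo := Diffeomorph.sumComm (𝓡 n) M.carrier ∞ N.carrier
  oriented := .of_sum
    ((Diffeomorph.sumComm (𝓡 n) M.carrier ∞ N.carrier).mdifferentiable (by simp)) .inr .inl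

variable (M) in
/-- `M ⊔ ∅ → M`. -/
noncomputable def sumEmpty : OrientedDiffeo (M.sum (ClosedManifold.empty n)) M where
  toDiffeo := Diffeomorph.sumEmpty (𝓡 n) M.carrier ∞
  oriented := .of_sum
    ((Diffeomorph.sumEmpty (𝓡 n) M.carrier ∞).mdifferentiable (by simp)) .id
    (fun x => isEmptyElim x)

variable (M) in
/-- `∅ ⊔ M → M`. -/
noncomputable def emptySum : OrientedDiffeo ((ClosedManifold.empty n).sum M) M :=
  (sumComm _ M).trans (sumEmpty M)

end OrientedDiffeo

/-- An oriented bordism from `M` to `N`: a compact smooth oriented `(n + 1)`-manifold with an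
orientation preserving diffeomorphism of `M̄ ⊔ N` with its boundary. The diffeomorphism consists of
smooth maps `inc` and `out` on `M` and `N`; they are immersions by the last two conditions.
Boundaries are oriented by the convention that the outward normal comes first. Thus `N` is compatible
with outward vectors `-v`, and `M`, whose opposite is part of the boundary, with inward vectors
`v`. -/
structure Bordism {n : ℕ} (M N : ClosedManifold.{u} n) : Type (u + 1) where
  carrier : Type u
  [topologicalSpace : TopologicalSpace carrier]
  [chartedSpace : ChartedSpace (BordismHalfSpace n) carrier]
  [isManifold : IsManifold (bordismModel n) ∞ carrier]
  [compactSpace : CompactSpace carrier]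
  [t2Space : T2Space carrier]
  orientation : ManifoldOrientation (bordismModel n) (n + 1) carrier
  inc : M.carrier → carrier
  out : N.carrier → carrier
  inc_smooth : ContMDiff (𝓡 n) (bordismModel n) ∞ inc
  out_smooth : ContMDiff (𝓡 n) (bordismModel n) ∞ out
  injective : Function.Injective (Sum.elim inc out)
  range_eq : range (Sum.elim inc out) = (bordismModel n).boundary carrier
  inc_oriented : ∀ x, ∃ v : TangentSpace (bordismModel n) (inc x), InwardPointing (inc x) v ∧
    TransverseOriented v (mfderiv (𝓡 n) (bordismModel n) inc x).toLinearMap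
      (M.orientation.orientationAt x) (orientation.orientationAt (inc x))
  out_oriented : ∀ y, ∃ v : TangentSpace (bordismModel n) (out y), InwardPointing (out y) v ∧
    TransverseOriented (-v) (mfderiv (𝓡 n) (bordismModel n) out y).toLinearMap
      (N.orientation.orientationAt y) (orientation.orientationAt (out y))

attribute [instance] Bordism.topologicalSpace Bordism.chartedSpace
  Bordism.isManifold Bordism.compactSpace Bordism.t2Space

theorem TransverseOriented.boundary_reparam {n : ℕ} {X X' W' : Type*}
    [TopologicalSpace X] [ChartedSpace (EuclideanSpace ℝ (Fin n)) X]
    [TopologicalSpace X'] [ChartedSpace (EuclideanSpace ℝ (Fin n)) X']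
    [TopologicalSpace W'] [ChartedSpace (BordismHalfSpace n) W']
    {i : X → X'} {f' : X' → W'} {x : X}
    (hi : MDifferentiableAt (𝓡 n) (𝓡 n) i x)
    (hf' : MDifferentiableAt (𝓡 n) (bordismModel n) f' (i x))
    {v : TangentSpace (bordismModel n) (f' (i x))}
    {o₁ : Orientation ℝ (TangentSpace (𝓡 n) x) (Fin n)}
    {o₂ : Orientation ℝ (TangentSpace (𝓡 n) (i x)) (Fin n)}
    {o₃ : Orientation ℝ (TangentSpace (bordismModel n) (f' (i x))) (Fin (n + 1))}
    (hi' : PreservesOrientation (mfderiv (𝓡 n) (𝓡 n) i x).toLinearMap o₁ o₂)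
    (h : TransverseOriented v (mfderiv (𝓡 n) (bordismModel n) (f' ∘ i) x).toLinearMap o₁ o₃) :
    TransverseOriented v (mfderiv (𝓡 n) (bordismModel n) f' (i x)).toLinearMap o₂ o₃ := by
  rw [mfderiv_comp x hf' hi, ContinuousLinearMap.toLinearMap_comp] at h
  exact h.of_comp_right hi'

theorem boundary_cylinder {n : ℕ} (M : ClosedManifold.{u} n) :
    (bordismModel n).boundary (M.carrier × unitInterval) = {p | p.2 = 0 ∨ p.2 = 1} := by
  rw [boundary_product]
  ext p
  exact ⟨fun h => h.2, fun h => ⟨trivial, h⟩⟩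

/-- The mapping cylinder of an orientation preserving diffeomorphism `f : M → N`: the bordism
`M × [0, 1]` with `M` identified with `M × {0}` by the identity and `N` with `M × {1}`
by `f⁻¹`. -/
noncomputable def Bordism.mappingCylinder {n : ℕ} {M N : ClosedManifold.{u} n}
    (f : OrientedDiffeo M N) : Bordism M N where
  carrier := M.carrier × unitInterval
  orientation := M.orientation.cylinder
  inc x := (x, 0)
  out y := (f.toDiffeo.symm y, 1)
  inc_smooth := contMDiff_id.prodMk contMDiff_const
  out_smooth := f.toDiffeo.symm.contMDiff.prodMk contMDiff_const
  injective := by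
    rintro (x | y) (x' | y') h <;> simp at h <;> simp [h]
  range_eq := by
    rw [boundary_cylinder]
    ext ⟨x, t⟩
    constructor
    · rintro ⟨y | y, h⟩
      · exact Or.inl (congrArg Prod.snd h).symm
      · exact Or.inr (congrArg Prod.snd h).symm
    · rintro (h | h)
      · exact ⟨Sum.inl x, Prod.ext rfl h.symm⟩
      · exact ⟨Sum.inr (f.toDiffeo x), Prod.ext (f.toDiffeo.symm_apply_apply x) h.symm⟩
  inc_oriented x := by
    refine ⟨cylinderVector (x, 0), cylinderVector_zero_inward x, ?_⟩
    rw [mfderiv_cylinderIncl]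
    exact M.orientation.cylinder_transverse (x, 0)
  out_oriented y := by
    refine ⟨-cylinderVector (f.toDiffeo.symm y, 1), cylinderVector_one_inward _, ?_⟩
    rw [neg_neg]
    have h1 : mfderiv (𝓡 n) (bordismModel n)
        (fun y => ((f.toDiffeo.symm y, 1) : M.carrier × unitInterval)) y
        = (mfderiv (𝓡 n) (bordismModel n) (fun x : M.carrier => (x, (1 : unitInterval)))
            (f.toDiffeo.symm y)).comp (mfderiv (𝓡 n) (𝓡 n) f.toDiffeo.symm y) :=
      mfderiv_comp y ((contMDiff_id.prodMk contMDiff_const).mdifferentiableAt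
        (n := ∞) (by simp)) (f.toDiffeo.symm.contMDiff.mdifferentiableAt (by simp))
    rw [h1, ContinuousLinearMap.toLinearMap_comp, mfderiv_cylinderIncl]
    refine (M.orientation.cylinder_transverse (f.toDiffeo.symm y, 1)).comp_right ?_
    exact f.symm.oriented y

/-- The cylinder `M × [0, 1]` as a bordism from `M ⊔ M̄` to `∅`. -/
noncomputable def Bordism.evaluation {n : ℕ} (M : ClosedManifold.{u} n) :
    Bordism (M.sum M.opp) (ClosedManifold.empty n) where
  carrier := M.carrier × unitInterval
  orientation := M.orientation.cylinder
  inc := Sum.elim (fun x => (x, 0)) (fun x => (x, 1))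
  out := isEmptyElim
  inc_smooth := (contMDiff_id.prodMk contMDiff_const).sumElim (contMDiff_id.prodMk contMDiff_const)
  out_smooth y := isEmptyElim y
  injective := by
    rintro ((x | x) | x) ((x' | x') | x') h <;>
      first
      | exact isEmptyElim x
      | exact isEmptyElim x'
      | exact congrArg (fun y => Sum.inl (Sum.inl y)) (congrArg Prod.fst h)
      | exact congrArg (fun y => Sum.inl (Sum.inr y)) (congrArg Prod.fst h)
      | exact absurd (congrArg Prod.snd h) zero_ne_one
      | exact absurd (congrArg Prod.snd h) one_ne_zero
  range_eq := by
    rw [boundary_cylinder]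
    ext ⟨x, t⟩
    constructor
    · rintro ⟨(y | y) | y, h⟩
      · exact Or.inl (congrArg Prod.snd h).symm
      · exact Or.inr (congrArg Prod.snd h).symm
      · exact isEmptyElim y
    · rintro (h | h)
      · exact ⟨Sum.inl (Sum.inl x), Prod.ext rfl h.symm⟩
      · exact ⟨Sum.inl (Sum.inr x), Prod.ext rfl h.symm⟩
  inc_oriented := by
    rintro (x | (x : M.carrier))
    · refine ⟨cylinderVector (x, 0), cylinderVector_zero_inward (M := M.carrier) x, ?_⟩
      have h := M.orientation.cylinder_transverse (x, 0)
      rw [← mfderiv_cylinderIncl] at h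
      exact TransverseOriented.boundary_reparam (i := (Sum.inl : M.carrier → M.carrier ⊕ M.carrier))
        (f' := Sum.elim (fun x : M.carrier => (x, (0 : unitInterval))) (fun x => (x, 1)))
        (ContMDiff.inl.mdifferentiableAt (n := 1) one_ne_zero)
        (((contMDiff_id.prodMk contMDiff_const).sumElim
          (contMDiff_id.prodMk contMDiff_const)).mdifferentiableAt (n := ∞) (by simp))
        (ManifoldOrientation.preserves_inl (M' := M.carrier) x (M.orientation.orientationAt x)) h
    · refine ⟨-cylinderVector (M := M.carrier) (x, 1),
        cylinderVector_one_inward (M := M.carrier) x, ?_⟩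
      have h := (M.orientation.cylinder_transverse (x, 1)).neg
      rw [← mfderiv_cylinderIncl] at h
      exact TransverseOriented.boundary_reparam (i := (Sum.inr : M.carrier → M.carrier ⊕ M.carrier))
        (f' := Sum.elim (fun x : M.carrier => (x, (0 : unitInterval))) (fun x => (x, 1)))
        (ContMDiff.inr.mdifferentiableAt (n := 1) one_ne_zero)
        (((contMDiff_id.prodMk contMDiff_const).sumElim
          (contMDiff_id.prodMk contMDiff_const)).mdifferentiableAt (n := ∞) (by simp))
        (ManifoldOrientation.preserves_inr (M := M.carrier) x (-M.orientation.orientationAt x)) h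
  out_oriented y := isEmptyElim y

/-- Two bordisms from `M` to `N` are equivalent if there is an orientation preserving diffeomorphism
between them that is compatible with the identifications of their boundaries. -/
def Bordism.Equivalent {n : ℕ} {M N : ClosedManifold.{u} n} (B B' : Bordism M N) : Prop :=
  ∃ φ : B.carrier ≃ₘ⟮bordismModel n, bordismModel n⟯ B'.carrier,
    OrientationPreserving B.orientation B'.orientation φ ∧ φ ∘ B.inc = B'.inc ∧ φ ∘ B.out = B'.out

/-- The bordism `C` from `L` to `N` is obtained by gluing the bordisms `B` from `L` to `M` and `B'`
from `M` to `N` along `M`: it is the union of images of `B` and `B'` under orientation preserving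
smooth embeddings that meet exactly in the two copies of `M`. (Such a `C` always exists, and it is
unique up to equivalence of bordisms, by the collar neighbourhood theorem.) -/
def Bordism.IsGluing {n : ℕ} {L M N : ClosedManifold.{u} n} (B : Bordism L M) (B' : Bordism M N)
    (C : Bordism L N) : Prop :=
  ∃ (i : B.carrier → C.carrier) (j : B'.carrier → C.carrier),
    ContMDiff (bordismModel n) (bordismModel n) ∞ i ∧
    ContMDiff (bordismModel n) (bordismModel n) ∞ j ∧
    OrientationPreserving B.orientation C.orientation i ∧
    OrientationPreserving B'.orientation C.orientation j ∧
    Function.Injective i ∧ Function.Injective j ∧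
    i ∘ B.out = j ∘ B'.inc ∧
    range i ∪ range j = univ ∧ range i ∩ range j = range (i ∘ B.out) ∧
    i ∘ B.inc = C.inc ∧ j ∘ B'.out = C.out

theorem InwardPointing.inl {n : ℕ} {W W' : Type*} [TopologicalSpace W]
    [ChartedSpace (BordismHalfSpace n) W] [TopologicalSpace W']
    [ChartedSpace (BordismHalfSpace n) W'] [IsManifold (bordismModel n) 1 W]
    [IsManifold (bordismModel n) 1 W'] {w : W} {v : TangentSpace (bordismModel n) w}
    (h : InwardPointing w v) :
    InwardPointing (Sum.inl w : W ⊕ W')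
      (mfderiv (bordismModel n) (bordismModel n) (Sum.inl : W → W ⊕ W') w v) := by
  unfold InwardPointing at h ⊢
  rw [ManifoldOrientation.mfderiv_extChartAt_inl (M' := W') w w (mem_chart_source _ _)] at h
  exact h

theorem InwardPointing.inr {n : ℕ} {W W' : Type*} [TopologicalSpace W]
    [ChartedSpace (BordismHalfSpace n) W] [TopologicalSpace W']
    [ChartedSpace (BordismHalfSpace n) W'] [IsManifold (bordismModel n) 1 W]
    [IsManifold (bordismModel n) 1 W'] {w : W'} {v : TangentSpace (bordismModel n) w}
    (h : InwardPointing w v) :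
    InwardPointing (Sum.inr w : W ⊕ W')
      (mfderiv (bordismModel n) (bordismModel n) (Sum.inr : W' → W ⊕ W') w v) := by
  unfold InwardPointing at h ⊢
  rw [ManifoldOrientation.mfderiv_extChartAt_inr (M := W) w w (mem_chart_source _ _)] at h
  exact h

/-- If a boundary parametrization `f` of `W` is compatible with orientations near `x`, so is the
induced parametrization of the boundary of a disjoint union. -/
theorem TransverseOriented.boundary_map {n : ℕ} {X X' W W' : Type*}
    [TopologicalSpace X] [ChartedSpace (EuclideanSpace ℝ (Fin n)) X]
    [TopologicalSpace X'] [ChartedSpace (EuclideanSpace ℝ (Fin n)) X']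
    [TopologicalSpace W] [ChartedSpace (BordismHalfSpace n) W]
    [TopologicalSpace W'] [ChartedSpace (BordismHalfSpace n) W']
    {f : X → W} {g : W → W'} {i : X → X'} {f' : X' → W'} {x : X}
    (hf : MDifferentiableAt (𝓡 n) (bordismModel n) f x)
    (hg : MDifferentiableAt (bordismModel n) (bordismModel n) g (f x))
    (hi : MDifferentiableAt (𝓡 n) (𝓡 n) i x)
    (hf' : MDifferentiableAt (𝓡 n) (bordismModel n) f' (i x))
    (hcomm : f' ∘ i = g ∘ f) {v : TangentSpace (bordismModel n) (f x)}
    {o₁ : Orientation ℝ (TangentSpace (𝓡 n) x) (Fin n)}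
    {o₂ : Orientation ℝ (TangentSpace (𝓡 n) (i x)) (Fin n)}
    {o₃ : Orientation ℝ (TangentSpace (bordismModel n) (f x)) (Fin (n + 1))}
    {o₄ : Orientation ℝ (TangentSpace (bordismModel n) (g (f x))) (Fin (n + 1))}
    (hi' : PreservesOrientation (mfderiv (𝓡 n) (𝓡 n) i x).toLinearMap o₁ o₂)
    (hg' : PreservesOrientation (mfderiv (bordismModel n) (bordismModel n) g (f x)).toLinearMap
      o₃ o₄)
    {v' : TangentSpace (bordismModel n) (g (f x))}
    (hv : v' = mfderiv (bordismModel n) (bordismModel n) g (f x) v)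
    (h : TransverseOriented v (mfderiv (𝓡 n) (bordismModel n) f x).toLinearMap o₁ o₃) :
    TransverseOriented (V := BordismSpace n) v'
      (mfderiv (𝓡 n) (bordismModel n) f' (i x)).toLinearMap o₂ o₄ := by
  subst hv
  refine TransverseOriented.of_comp_right (V := BordismSpace n)
    (A := (mfderiv (𝓡 n) (bordismModel n) f' (i x)).toLinearMap) ?_ hi'
  have h1 := h.map hg'
  have h0 : ∀ k k' : X → W', k = k' →
      (show EuclideanSpace ℝ (Fin n) →L[ℝ] BordismSpace n from
        mfderiv (𝓡 n) (bordismModel n) k x) = mfderiv (𝓡 n) (bordismModel n) k' x := by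
    rintro k _ rfl
    rfl
  have h2 : (show EuclideanSpace ℝ (Fin n) →L[ℝ] BordismSpace n from
        (mfderiv (𝓡 n) (bordismModel n) f' (i x)).comp (mfderiv (𝓡 n) (𝓡 n) i x))
      = (mfderiv (bordismModel n) (bordismModel n) g (f x)).comp
        (mfderiv (𝓡 n) (bordismModel n) f x) :=
    (mfderiv_comp x hf' hi).symm.trans ((h0 _ _ hcomm).trans (mfderiv_comp x hg hf))
  have h3 := congrArg (fun k : EuclideanSpace ℝ (Fin n) →L[ℝ] BordismSpace n => k.toLinearMap) h2
  have h4 : ∀ T T' : EuclideanSpace ℝ (Fin n) →ₗ[ℝ] BordismSpace n, T = T' →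
      TransverseOriented (V := BordismSpace n)
        (mfderiv (bordismModel n) (bordismModel n) g (f x) v) T' o₁ o₄ →
      TransverseOriented (V := BordismSpace n)
        (mfderiv (bordismModel n) (bordismModel n) g (f x) v) T o₁ o₄ := by
    rintro T _ rfl h
    exact h
  exact h4 _ _ h3 h1

/-- The disjoint union of two bordisms. -/
noncomputable def Bordism.sum {n : ℕ} {M N M' N' : ClosedManifold.{u} n} (B : Bordism M N)
    (B' : Bordism M' N') : Bordism (M.sum M') (N.sum N') where
  carrier := B.carrier ⊕ B'.carrier
  orientation := B.orientation.sum B'.orientation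
  inc := Sum.map B.inc B'.inc
  out := Sum.map B.out B'.out
  inc_smooth := B.inc_smooth.sumMap B'.inc_smooth
  out_smooth := B.out_smooth.sumMap B'.out_smooth
  injective := by
    have h := B.injective
    have h' := B'.injective
    rintro ((x | x) | (x | x)) ((y | y) | (y | y)) hxy
    · exact congrArg (Sum.map Sum.inl Sum.inl)
        (h (a₁ := Sum.inl x) (a₂ := Sum.inl y) (Sum.inl_injective hxy))
    · cases hxy
    · exact congrArg (Sum.map Sum.inl Sum.inl)
        (h (a₁ := Sum.inl x) (a₂ := Sum.inr y) (Sum.inl_injective hxy))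
    · cases hxy
    · cases hxy
    · exact congrArg (Sum.map Sum.inr Sum.inr)
        (h' (a₁ := Sum.inl x) (a₂ := Sum.inl y) (Sum.inr_injective hxy))
    · cases hxy
    · exact congrArg (Sum.map Sum.inr Sum.inr)
        (h' (a₁ := Sum.inl x) (a₂ := Sum.inr y) (Sum.inr_injective hxy))
    · exact congrArg (Sum.map Sum.inl Sum.inl)
        (h (a₁ := Sum.inr x) (a₂ := Sum.inl y) (Sum.inl_injective hxy))
    · cases hxy
    · exact congrArg (Sum.map Sum.inl Sum.inl)
        (h (a₁ := Sum.inr x) (a₂ := Sum.inr y) (Sum.inl_injective hxy))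
    · cases hxy
    · cases hxy
    · exact congrArg (Sum.map Sum.inr Sum.inr)
        (h' (a₁ := Sum.inr x) (a₂ := Sum.inl y) (Sum.inr_injective hxy))
    · cases hxy
    · exact congrArg (Sum.map Sum.inr Sum.inr)
        (h' (a₁ := Sum.inr x) (a₂ := Sum.inr y) (Sum.inr_injective hxy))
  range_eq := by
    rw [ModelWithCorners.boundary_disjointUnion, ← B.range_eq, ← B'.range_eq]
    ext w
    constructor
    · rintro ⟨(x | x) | (x | x), rfl⟩
      · exact Or.inl ⟨_, ⟨Sum.inl x, rfl⟩, rfl⟩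
      · exact Or.inr ⟨_, ⟨Sum.inl x, rfl⟩, rfl⟩
      · exact Or.inl ⟨_, ⟨Sum.inr x, rfl⟩, rfl⟩
      · exact Or.inr ⟨_, ⟨Sum.inr x, rfl⟩, rfl⟩
    · rintro (⟨_, ⟨x | x, rfl⟩, rfl⟩ | ⟨_, ⟨x | x, rfl⟩, rfl⟩)
      · exact ⟨Sum.inl (Sum.inl x), rfl⟩
      · exact ⟨Sum.inr (Sum.inl x), rfl⟩
      · exact ⟨Sum.inl (Sum.inr x), rfl⟩
      · exact ⟨Sum.inr (Sum.inr x), rfl⟩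
  inc_oriented := by
    have hd : MDifferentiable (𝓡 n) (bordismModel n) (Sum.map B.inc B'.inc) :=
      (B.inc_smooth.sumMap B'.inc_smooth).mdifferentiable (by simp)
    rintro (x | x)
    · obtain ⟨v, hv, h⟩ := B.inc_oriented x
      exact ⟨_, hv.inl, TransverseOriented.boundary_map (i := Sum.inl) (g := Sum.inl)
        (B.inc_smooth.mdifferentiableAt (by simp))
        (ContMDiff.inl.mdifferentiableAt (n := 1) one_ne_zero)
        (ContMDiff.inl.mdifferentiableAt (n := 1) one_ne_zero) (hd _) rfl
        (ManifoldOrientation.preserves_inl x _) (ManifoldOrientation.preserves_inl _ _) rfl h⟩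
    · obtain ⟨v, hv, h⟩ := B'.inc_oriented x
      exact ⟨_, hv.inr, TransverseOriented.boundary_map (i := Sum.inr) (g := Sum.inr)
        (B'.inc_smooth.mdifferentiableAt (by simp))
        (ContMDiff.inr.mdifferentiableAt (n := 1) one_ne_zero)
        (ContMDiff.inr.mdifferentiableAt (n := 1) one_ne_zero) (hd _) rfl
        (ManifoldOrientation.preserves_inr x _) (ManifoldOrientation.preserves_inr _ _) rfl h⟩
  out_oriented := by
    have hd : MDifferentiable (𝓡 n) (bordismModel n) (Sum.map B.out B'.out) :=
      (B.out_smooth.sumMap B'.out_smooth).mdifferentiable (by simp)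
    rintro (x | x)
    · obtain ⟨v, hv, h⟩ := B.out_oriented x
      refine ⟨_, hv.inl, ?_⟩
      exact TransverseOriented.boundary_map (i := Sum.inl) (g := Sum.inl)
        (B.out_smooth.mdifferentiableAt (by simp))
        (ContMDiff.inl.mdifferentiableAt (n := 1) one_ne_zero)
        (ContMDiff.inl.mdifferentiableAt (n := 1) one_ne_zero) (hd _) rfl
        (ManifoldOrientation.preserves_inl x _) (ManifoldOrientation.preserves_inl _ _) (map_neg _ v).symm h
    · obtain ⟨v, hv, h⟩ := B'.out_oriented x
      refine ⟨_, hv.inr, ?_⟩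
      exact TransverseOriented.boundary_map (i := Sum.inr) (g := Sum.inr)
        (B'.out_smooth.mdifferentiableAt (by simp))
        (ContMDiff.inr.mdifferentiableAt (n := 1) one_ne_zero)
        (ContMDiff.inr.mdifferentiableAt (n := 1) one_ne_zero) (hd _) rfl
        (ManifoldOrientation.preserves_inr x _) (ManifoldOrientation.preserves_inr _ _) (map_neg _ v).symm h


/-- Expressions built from bordisms by gluing (`comp`) and disjoint union (`tensor`). As the smooth
structure of a glued manifold is only determined up to diffeomorphism, gluing is not an operation on
bordisms themselves, but an operation on such expressions; `BordismWord.Rel` identifies an expression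
with the bordisms that it produces. -/
inductive BordismWord (n : ℕ) : ClosedManifold.{u} n → ClosedManifold.{u} n → Type (u + 1)
  | of {M N : ClosedManifold.{u} n} (B : Bordism M N) : BordismWord n M N
  | comp {L M N : ClosedManifold.{u} n} (f : BordismWord n L M) (g : BordismWord n M N) :
      BordismWord n L N
  | tensor {M N M' N' : ClosedManifold.{u} n} (f : BordismWord n M N) (g : BordismWord n M' N') :
      BordismWord n (M.sum M') (N.sum N')

namespace BordismWord

variable {n : ℕ}

/-- The mapping cylinder of an orientation preserving diffeomorphism. -/
noncomputable def cyl {M N : ClosedManifold.{u} n} (f : OrientedDiffeo M N) : BordismWord n M N :=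
  .of (.mappingCylinder f)

/-- Two expressions define the same morphism of the bordism category. The relations `diffeo`, `glue`
and `disjoint` say that bordisms are taken up to diffeomorphism relative to the boundary, that the
composite of two bordisms is the result of gluing them, and that their tensor product is their disjoint
union. The other relations say that mapping cylinders are functorial, that the cylinders
`M × [0, 1]` are the identities, that `comp` and `tensor` are associative and functorial, and that the
canonical diffeomorphisms between disjoint unions are natural. All of them hold for glued bordisms up
to diffeomorphism relative to the boundary. Since every expression is equivalent to a single
bordism, the classes of expressions are exactly the diffeomorphism classes of bordisms. -/
inductive Rel : ∀ {M N : ClosedManifold.{u} n}, BordismWord n M N → BordismWord n M N → Prop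
  | refl {M N : ClosedManifold.{u} n} (f : BordismWord n M N) : Rel f f
  | symm {M N : ClosedManifold.{u} n} {f g : BordismWord n M N} : Rel f g → Rel g f
  | trans {M N : ClosedManifold.{u} n} {f g h : BordismWord n M N} : Rel f g → Rel g h → Rel f h
  | comp {L M N : ClosedManifold.{u} n} {f f' : BordismWord n L M} {g g' : BordismWord n M N} :
      Rel f f' → Rel g g' → Rel (f.comp g) (f'.comp g')
  | tensor {M N M' N' : ClosedManifold.{u} n} {f f' : BordismWord n M N}
      {g g' : BordismWord n M' N'} : Rel f f' → Rel g g' → Rel (f.tensor g) (f'.tensor g')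
  | diffeo {M N : ClosedManifold.{u} n} {B B' : Bordism M N} (h : B.Equivalent B') :
      Rel (.of B) (.of B')
  | glue {L M N : ClosedManifold.{u} n} {B : Bordism L M} {B' : Bordism M N} {C : Bordism L N}
      (h : B.IsGluing B' C) : Rel ((of B).comp (of B')) (of C)
  | disjoint {M N M' N' : ClosedManifold.{u} n} (B : Bordism M N) (B' : Bordism M' N') :
      Rel ((of B).tensor (of B')) (of (B.sum B'))
  | cyl_comp {L M N : ClosedManifold.{u} n} (f : OrientedDiffeo L M) (g : OrientedDiffeo M N) :
      Rel ((cyl f).comp (cyl g)) (cyl (f.trans g))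
  | cyl_tensor {M N M' N' : ClosedManifold.{u} n} (f : OrientedDiffeo M N)
      (g : OrientedDiffeo M' N') : Rel ((cyl f).tensor (cyl g)) (cyl (f.sum g))
  | id_comp {M N : ClosedManifold.{u} n} (f : BordismWord n M N) : Rel ((cyl (.refl M)).comp f) f
  | comp_id {M N : ClosedManifold.{u} n} (f : BordismWord n M N) : Rel (f.comp (cyl (.refl N))) f
  | assoc {K L M N : ClosedManifold.{u} n} (f : BordismWord n K L) (g : BordismWord n L M)
      (h : BordismWord n M N) : Rel ((f.comp g).comp h) (f.comp (g.comp h))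
  | tensor_comp {L M N L' M' N' : ClosedManifold.{u} n} (f : BordismWord n L M)
      (g : BordismWord n M N) (f' : BordismWord n L' M') (g' : BordismWord n M' N') :
      Rel ((f.tensor f').comp (g.tensor g')) ((f.comp g).tensor (f'.comp g'))
  | assoc_nat {M₁ M₂ M₃ N₁ N₂ N₃ : ClosedManifold.{u} n} (f₁ : BordismWord n M₁ N₁)
      (f₂ : BordismWord n M₂ N₂) (f₃ : BordismWord n M₃ N₃) :
      Rel (((f₁.tensor f₂).tensor f₃).comp (cyl (.sumAssoc N₁ N₂ N₃)))
        ((cyl (.sumAssoc M₁ M₂ M₃)).comp (f₁.tensor (f₂.tensor f₃)))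
  | left_nat {M N : ClosedManifold.{u} n} (f : BordismWord n M N) :
      Rel (((cyl (.refl (.empty n))).tensor f).comp (cyl (.emptySum N)))
        ((cyl (.emptySum M)).comp f)
  | right_nat {M N : ClosedManifold.{u} n} (f : BordismWord n M N) :
      Rel ((f.tensor (cyl (.refl (.empty n)))).comp (cyl (.sumEmpty N)))
        ((cyl (.sumEmpty M)).comp f)
  | comm_nat {M N M' N' : ClosedManifold.{u} n} (f : BordismWord n M N)
      (f' : BordismWord n M' N') :
      Rel ((f.tensor f').comp (cyl (.sumComm N N'))) ((cyl (.sumComm M M')).comp (f'.tensor f))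

/-- The equivalence relation whose classes are the morphisms of the bordism category. -/
def setoid (M N : ClosedManifold.{u} n) : Setoid (BordismWord n M N) where
  r := Rel
  iseqv := ⟨.refl, .symm, .trans⟩

end BordismWord

/-- The bordism category `Cob(n)`: its objects are the closed oriented `n`-manifolds, its morphisms
are the oriented bordisms up to diffeomorphism relative to the boundary, and composition is
gluing. -/
abbrev Cob (n : ℕ) : Type (u + 1) := ClosedManifold.{u} n

namespace Cob

open MonoidalCategory

variable {n : ℕ}

noncomputable instance : Category (Cob.{u} n) where
  Hom M N := Quotient (BordismWord.setoid M N)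
  id M := ⟦.cyl (.refl M)⟧
  comp := Quotient.map₂ .comp fun _ _ h _ _ h' => .comp h h'
  id_comp := by
    rintro _ _ ⟨f⟩
    exact Quotient.sound (.id_comp f)
  comp_id := by
    rintro _ _ ⟨f⟩
    exact Quotient.sound (.comp_id f)
  assoc := by
    rintro _ _ _ _ ⟨f⟩ ⟨g⟩ ⟨h⟩
    exact Quotient.sound (.assoc f g h)

/-- The morphism given by a bordism. -/
def ofBordism {M N : Cob.{u} n} (B : Bordism M N) : M ⟶ N :=
  Quotient.mk (BordismWord.setoid _ _) (.of B)

/-- The morphism given by the mapping cylinder of an orientation preserving diffeomorphism. -/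
noncomputable def ofDiffeo {M N : Cob.{u} n} (f : OrientedDiffeo M N) : M ⟶ N :=
  ofBordism (.mappingCylinder f)

theorem ofDiffeo_comp {L M N : Cob.{u} n} (f : OrientedDiffeo L M)
    (g : OrientedDiffeo M N) :
    ofDiffeo f ≫ ofDiffeo g = ofDiffeo (f.trans g) :=
  Quotient.sound (.cyl_comp f g)

theorem ofDiffeo_refl (M : Cob.{u} n) : ofDiffeo (.refl M) = 𝟙 M := rfl

/-- An orientation preserving diffeomorphism gives an isomorphism. -/
noncomputable def isoOfDiffeo {M N : Cob.{u} n} (f : OrientedDiffeo M N) :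
    M ≅ N where
  hom := ofDiffeo f
  inv := ofDiffeo f.symm
  hom_inv_id := by
    rw [ofDiffeo_comp, ← ofDiffeo_refl]
    congr 1
    exact OrientedDiffeo.ext_of_apply fun x => f.toDiffeo.symm_apply_apply x
  inv_hom_id := by
    rw [ofDiffeo_comp, ← ofDiffeo_refl]
    congr 1
    exact OrientedDiffeo.ext_of_apply fun x => f.toDiffeo.apply_symm_apply x

/-- The disjoint union of morphisms. -/
noncomputable def tensorHom {M N M' N' : Cob.{u} n} (f : M ⟶ N) (g : M' ⟶ N') :
    (M.sum M' : Cob.{u} n) ⟶ N.sum N' :=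
  Quotient.map₂ (sa := BordismWord.setoid _ _) (sb := BordismWord.setoid _ _)
    (sc := BordismWord.setoid _ _) .tensor (fun _ _ h _ _ h' => .tensor h h') f g

theorem tensorHom_ofDiffeo {M N M' N' : Cob.{u} n} (f : OrientedDiffeo M N)
    (g : OrientedDiffeo M' N') :
    tensorHom (ofDiffeo f) (ofDiffeo g) = ofDiffeo (f.sum g) :=
  Quotient.sound (.cyl_tensor f g)

/-- The monoidal structure of `Cob(n)` is the disjoint union, with the empty manifold as unit. -/
noncomputable instance : MonoidalCategoryStruct (Cob.{u} n) where
  tensorObj M N := ClosedManifold.sum M N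
  tensorUnit := ClosedManifold.empty n
  tensorHom := tensorHom
  whiskerLeft M _ _ f := tensorHom (𝟙 M) f
  whiskerRight f N := tensorHom f (𝟙 N)
  associator L M N := isoOfDiffeo (.sumAssoc L M N)
  leftUnitor M := isoOfDiffeo (.emptySum M)
  rightUnitor M := isoOfDiffeo (.sumEmpty M)

noncomputable instance : MonoidalCategory (Cob.{u} n) := .ofTensorHom
  (id_tensorHom_id := fun M N => by
    change tensorHom (ofDiffeo (.refl M)) (ofDiffeo (.refl N)) = ofDiffeo _
    rw [tensorHom_ofDiffeo]
    congr 1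
    exact OrientedDiffeo.ext_of_apply fun x => by rcases x with x | x <;> rfl)
  (id_tensorHom := fun _ _ _ _ => rfl)
  (tensorHom_id := fun _ _ => rfl)
  (tensorHom_comp_tensorHom := by
    rintro _ _ _ _ _ _ ⟨f₁⟩ ⟨f₂⟩ ⟨g₁⟩ ⟨g₂⟩
    exact Quotient.sound (.tensor_comp f₁ g₁ f₂ g₂))
  (associator_naturality := by
    rintro _ _ _ _ _ _ ⟨f₁⟩ ⟨f₂⟩ ⟨f₃⟩
    exact Quotient.sound (.assoc_nat f₁ f₂ f₃))
  (leftUnitor_naturality := by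
    rintro _ _ ⟨f⟩
    exact Quotient.sound (.left_nat f))
  (rightUnitor_naturality := by
    rintro _ _ ⟨f⟩
    exact Quotient.sound (.right_nat f))
  (pentagon := fun K L M N => by
    change tensorHom (ofDiffeo (.sumAssoc _ _ _)) (ofDiffeo (.refl _)) ≫
      ofDiffeo (.sumAssoc _ _ _) ≫ tensorHom (ofDiffeo (.refl _)) (ofDiffeo (.sumAssoc _ _ _)) =
      ofDiffeo (.sumAssoc _ _ _) ≫ ofDiffeo (.sumAssoc _ _ _)
    simp only [tensorHom_ofDiffeo, ofDiffeo_comp]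
    congr 1
    exact OrientedDiffeo.ext_of_apply fun x => by rcases x with ((x | x) | x) | x <;> rfl)
  (triangle := fun M N => by
    change ofDiffeo (.sumAssoc _ _ _) ≫ tensorHom (ofDiffeo (.refl _)) (ofDiffeo (.emptySum _)) =
      tensorHom (ofDiffeo (.sumEmpty _)) (ofDiffeo (.refl _))
    simp only [tensorHom_ofDiffeo, ofDiffeo_comp]
    congr 1
    exact OrientedDiffeo.ext_of_apply fun x => by
      rcases x with (x | x) | x
      · rfl
      · exact isEmptyElim (α := (ClosedManifold.empty n).carrier) x
      · rfl)

noncomputable instance : SymmetricCategory (Cob.{u} n) where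
  braiding M N := isoOfDiffeo (.sumComm M N)
  braiding_naturality_right := by
    rintro M _ _ ⟨f⟩
    exact Quotient.sound (.comm_nat (.cyl (.refl M)) f)
  braiding_naturality_left := by
    rintro _ _ ⟨f⟩ M
    exact Quotient.sound (.comm_nat f (.cyl (.refl M)))
  hexagon_forward L M N := by
    change ofDiffeo (.sumAssoc _ _ _) ≫ ofDiffeo (.sumComm _ _) ≫ ofDiffeo (.sumAssoc _ _ _) =
      tensorHom (ofDiffeo (.sumComm _ _)) (ofDiffeo (.refl _)) ≫ ofDiffeo (.sumAssoc _ _ _) ≫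
        tensorHom (ofDiffeo (.refl _)) (ofDiffeo (.sumComm _ _))
    simp only [tensorHom_ofDiffeo, ofDiffeo_comp]
    congr 1
    exact OrientedDiffeo.ext_of_apply fun x => by rcases x with (x | x) | x <;> rfl
  hexagon_reverse L M N := by
    change ofDiffeo (OrientedDiffeo.sumAssoc _ _ _).symm ≫ ofDiffeo (.sumComm _ _) ≫
        ofDiffeo (OrientedDiffeo.sumAssoc _ _ _).symm =
      tensorHom (ofDiffeo (.refl _)) (ofDiffeo (.sumComm _ _)) ≫
        ofDiffeo (OrientedDiffeo.sumAssoc _ _ _).symm ≫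
        tensorHom (ofDiffeo (.sumComm _ _)) (ofDiffeo (.refl _))
    simp only [tensorHom_ofDiffeo, ofDiffeo_comp]
    congr 1
    exact OrientedDiffeo.ext_of_apply fun x => by rcases x with x | (x | x) <;> rfl
  symmetry M N := by
    change ofDiffeo (.sumComm _ _) ≫ ofDiffeo (.sumComm _ _) = ofDiffeo (.refl _)
    rw [ofDiffeo_comp]
    congr 1
    exact OrientedDiffeo.ext_of_apply fun x => by rcases x with x | x <;> rfl

/-- The evaluation `M ⊔ M̄ → ∅`, given by the cylinder `M × [0, 1]`. -/
noncomputable def ev (M : Cob.{u} n) : M ⊗ (M.opp : Cob.{u} n) ⟶ 𝟙_ (Cob.{u} n) :=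
  ofBordism (.evaluation M)

end Cob

/-- For a functor `Z : Cob(n) ⥤ Vect(k)` that is monoidal, the pairing
`Z(M) ⊗ Z(M̄) ≅ Z(M ⊔ M̄) → Z(∅) ≅ k` induced by the evaluation bordism. -/
noncomputable def evaluationPairing {n : ℕ} {k : Type v} [Field k] (Z : Cob.{u} n ⥤ ModuleCat.{v} k)
    [Z.Monoidal] (M : Cob.{u} n) : Z.obj M →ₗ[k] Z.obj M.opp →ₗ[k] k :=
  TensorProduct.curry
    (Functor.LaxMonoidal.μ Z M M.opp ≫ Z.map (Cob.ev M) ≫ Functor.OplaxMonoidal.η Z).hom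

/-!
The manifold `M̄` is a dual of `M` in the monoidal category `Cob(n)`: besides the evaluation
`M ⊔ M̄ → ∅` the cylinder `M × [0, 1]` also gives a coevaluation `∅ → M̄ ⊔ M`, and both zigzag
composites `M → M ⊔ M̄ ⊔ M → M` and `M̄ → M̄ ⊔ M ⊔ M̄ → M̄` are four cylinders glued end to end, hence
cylinders (`Cob.exactPairing`). A monoidal functor preserves dual objects
(`CategoryTheory.ExactPairing.map`), so `Z(M̄)` and `Z(M)` are dual in `Vect(k)`. If the coevaluation
there sends `1` to `∑ wᵢ ⊗ vᵢ`, the zigzag identities say that `x = ∑ ⟨x, wᵢ⟩ vᵢ` and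
`w = ∑ ⟨vᵢ, w⟩ wᵢ` (`ModuleCat.exists_dual_families`). Hence the `vᵢ` span `Z(M)`, and the pairing is
nondegenerate on both sides.

In `Cob(n)` a composite is known only once a bordism is exhibited that is covered by the two factors,
so the gluings are done explicitly. All the embeddings are products of an inclusion of the base with
an affine map `unitInterval.segment a b` of intervals; such a map preserves the orientation of the
cylinder if it is increasing, or if it is decreasing and the base is reversed. The associator in the
zigzags is the mapping cylinder of a diffeomorphism, and gluing it only reparametrizes the outgoing
end, because the bordism before it has collars (`Bordism.IsGluing.mapOut`). The two remaining gluings,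
`Bordism.isGluing_zigzag` and `Bordism.isGluing_zigzag_opp`, cut `[0, 1]` at three points
`a < b < c`. In the second one the evaluation and coevaluation are traversed backwards, which is
compatible with orientations because the ambient cylinder is that of `M̄`.
-/

/-! ### Affine maps of the unit interval -/

section Segment

/-- The affine map `[0, 1] → [0, 1]` with `0 ↦ a` and `1 ↦ b`; it reverses direction if `b < a`. -/
def unitInterval.segment (a b t : unitInterval) : unitInterval :=
  ⟨a + t * (b - a), by
    have h : (a : ℝ) + t * (b - a) = (1 - t) * a + t * b := by ring
    rw [h]
    exact convex_Icc (0 : ℝ) 1 a.2 b.2 (sub_nonneg.mpr t.2.2) t.2.1 (by ring)⟩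

namespace unitInterval

variable {a b : unitInterval}

theorem coe_segment (a b t : unitInterval) : (segment a b t : ℝ) = a + t * (b - a) := rfl

@[simp] theorem segment_zero (a b : unitInterval) : segment a b 0 = a := by
  ext; simp [coe_segment]

@[simp] theorem segment_one (a b : unitInterval) : segment a b 1 = b := by
  ext; simp [coe_segment]

theorem segment_injective (h : a ≠ b) : Function.Injective (segment a b) := by
  intro t t' htt
  have h1 : (b : ℝ) - a ≠ 0 := sub_ne_zero.mpr fun h2 => h (Subtype.ext h2.symm)
  have h2 := congrArg (Subtype.val : unitInterval → ℝ) htt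
  rw [coe_segment, coe_segment, add_right_inj] at h2
  exact Subtype.ext (mul_right_cancel₀ h1 h2)

theorem range_segment (h : a < b) : range (segment a b) = Icc a b := by
  have h1 : (0 : ℝ) < b - a := sub_pos.mpr h
  ext s
  constructor
  · rintro ⟨t, rfl⟩
    constructor
    · change (a : ℝ) ≤ a + t * (b - a)
      nlinarith [t.2.1]
    · change (a : ℝ) + t * (b - a) ≤ b
      nlinarith [t.2.2]
  · rintro ⟨h2, h3⟩
    have h2' : (a : ℝ) ≤ s := h2
    have h3' : (s : ℝ) ≤ b := h3
    refine ⟨⟨(s - a) / (b - a), div_nonneg (by linarith) h1.le, (div_le_one h1).mpr (by linarith)⟩,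
      Subtype.ext ?_⟩
    rw [coe_segment]
    field_simp
    ring

theorem segment_symm (a b t : unitInterval) : segment a b (unitInterval.symm t) = segment b a t := by
  ext; simp only [coe_segment, coe_symm_eq]; ring

theorem range_segment_of_gt (h : b < a) : range (segment a b) = Icc b a := by
  rw [← range_segment h, ← (show segment a b ∘ unitInterval.symm = segment b a from
    funext (segment_symm a b)), range_comp,
    unitInterval.symm_bijective.surjective.range_eq, image_univ]

theorem contMDiff_segment (a b : unitInterval) : ContMDiff (𝓡∂ 1) (𝓡∂ 1) ∞ (segment a b) := by
  have hc : Continuous (segment a b) :=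
    Continuous.subtype_mk
      (continuous_const.add (continuous_subtype_val.mul continuous_const)) _
  refine (contMDiff_iff_comp_subtypeVal_Icc (x := 0) (y := 1) (n := ∞)).mpr ⟨hc, ?_⟩
  exact (contDiff_const.add (contDiff_id.mul contDiff_const) :
    ContDiff ℝ ∞ fun t : ℝ => (a : ℝ) + t * (b - a)).contMDiff.comp
      (contMDiff_subtypeVal_Icc (x := 0) (y := 1))

/-- The tangent spaces of `[0, 1]` are lines spanned by the unit tangent vector. -/
theorem exists_eq_smul_oneTangentSpaceIcc (t : unitInterval) (v : TangentSpace (𝓡∂ 1) t) :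
    ∃ r : ℝ, v = r • oneTangentSpaceIcc t := by
  have h : Module.finrank ℝ (EuclideanSpace ℝ (Fin 1)) = 1 := by simp
  obtain ⟨r, hr⟩ := exists_smul_eq_of_finrank_eq_one h (unitInterval_one_ne_zero t) v
  exact ⟨r, hr.symm⟩

theorem mfderiv_segment (a b t : unitInterval) :
    mfderiv (𝓡∂ 1) (𝓡∂ 1) (segment a b) t (oneTangentSpaceIcc t) =
      ((b : ℝ) - a) • oneTangentSpaceIcc (segment a b t) := by
  obtain ⟨r, hr⟩ := exists_eq_smul_oneTangentSpaceIcc (segment a b t)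
    (mfderiv (𝓡∂ 1) (𝓡∂ 1) (segment a b) t (oneTangentSpaceIcc t))
  rw [hr]
  congr 1
  -- The scalar `r` is determined after composition with the inclusion of `[0, 1]` in `ℝ`.
  have hd (s : unitInterval) : MDifferentiableAt (𝓡∂ 1) 𝓘(ℝ) (Subtype.val : unitInterval → ℝ) s :=
    (contMDiff_subtypeVal_Icc (n := 1) (x := 0) (y := 1)).mdifferentiableAt one_ne_zero
  have hone (s : unitInterval) :
      mfderiv (𝓡∂ 1) 𝓘(ℝ) (Subtype.val : unitInterval → ℝ) s (oneTangentSpaceIcc s) = (1 : ℝ) :=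
    mfderiv_subtypeVal_Icc_one s
  have hL : HasFDerivAt (fun s : ℝ => (a : ℝ) + s * (b - a))
      ((ContinuousLinearMap.id ℝ ℝ).smulRight ((b : ℝ) - a)) (t : ℝ) :=
    ((hasFDerivAt_id (t : ℝ)).smul_const _).const_add _
  have h1 := (HasMFDerivAt.comp t hL.hasMFDerivAt (hd t).hasMFDerivAt).mfderiv
  have h2 : mfderiv (𝓡∂ 1) 𝓘(ℝ) ((Subtype.val : unitInterval → ℝ) ∘ segment a b) t = _ :=
    mfderiv_comp t (hd _) ((contMDiff_segment a b).mdifferentiableAt (by simp))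
  have h3 : mfderiv (𝓡∂ 1) 𝓘(ℝ) ((Subtype.val : unitInterval → ℝ) ∘ segment a b) t
      (oneTangentSpaceIcc t) = r := by
    rw [h2]
    change mfderiv (𝓡∂ 1) 𝓘(ℝ) (Subtype.val : unitInterval → ℝ) (segment a b t)
      (mfderiv (𝓡∂ 1) (𝓡∂ 1) (segment a b) t (oneTangentSpaceIcc t)) = r
    rw [hr, map_smul, hone]
    exact mul_one r
  have h4 : mfderiv (𝓡∂ 1) 𝓘(ℝ) ((Subtype.val : unitInterval → ℝ) ∘ segment a b) t
      (oneTangentSpaceIcc t) = ((b : ℝ) - a : ℝ) := by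
    refine (DFunLike.congr_fun h1 (oneTangentSpaceIcc t)).trans ?_
    change (ContinuousLinearMap.smulRight _ _) (mfderiv (𝓡∂ 1) 𝓘(ℝ)
      (Subtype.val : unitInterval → ℝ) t (oneTangentSpaceIcc t)) = _
    rw [hone]
    exact one_smul ℝ _
  exact h3.symm.trans h4

end unitInterval

end Segment

/-! ### Maps of cylinders -/

section CylinderMaps

variable {n : ℕ}

theorem TransverseOriented.of_pos_smul {U V : Type*} [AddCommGroup U] [Module ℝ U] [AddCommGroup V]
    [Module ℝ V] {v : V} {A : U →ₗ[ℝ] V} {o : Orientation ℝ U (Fin n)}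
    {o' : Orientation ℝ V (Fin (n + 1))} {c : ℝ} (hc : 0 < c)
    (h : TransverseOriented (c • v) A o o') : TransverseOriented v A o o' := by
  obtain ⟨η, hη, h0, h1, h2⟩ := h
  have key : (η.curryLeft (c • v)).compLinearMap A = c • ((η.curryLeft v).compLinearMap A) := by
    rw [map_smul]; rfl
  have h0' : (η.curryLeft v).compLinearMap A ≠ 0 := fun h => h0 (by rw [key, h, smul_zero])
  refine ⟨η, hη, h0', h1, h2 ▸ (ray_eq_iff _ _).mpr ?_⟩
  rw [key]
  exact SameRay.sameRay_pos_smul_right _ hc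

variable {M : Type*} [TopologicalSpace M] [ChartedSpace (EuclideanSpace ℝ (Fin n)) M]
  [IsManifold (𝓡 n) 1 M]
  {N : Type*} [TopologicalSpace N] [ChartedSpace (EuclideanSpace ℝ (Fin n)) N]
  {o : ManifoldOrientation (𝓡 n) n M} {o' : ManifoldOrientation (𝓡 n) n N}
  {f : M → N} {a b : unitInterval}

open unitInterval

/-- The derivative of `f × segment a b` carries the orientation of `M × [0, 1]` to the orientation of
`N × [0, 1]` given by the vector `(b - a) ∂/∂t` followed by the orientation of `N`. -/
theorem exists_map_cylinder (hf : MDifferentiable (𝓡 n) (𝓡 n) f)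
    (hfo : OrientationPreserving o o' f) (hab : a ≠ b) (p : M × unitInterval) :
    ∃ o'' : Orientation ℝ (TangentSpace (bordismModel n) (f p.1, segment a b p.2)) (Fin (n + 1)),
      PreservesOrientation
        (mfderiv (bordismModel n) (bordismModel n) (Prod.map f (segment a b)) p).toLinearMap
        (o.cylinder.orientationAt p) o'' ∧
      TransverseOriented (((b : ℝ) - a) • cylinderVector (n := n) (f p.1, segment a b p.2))
        (cylinderIncl (f p.1, segment a b p.2)) (o'.orientationAt (f p.1)) o'' := by
  have hc : (b : ℝ) - a ≠ 0 := sub_ne_zero.mpr fun h2 => hab (Subtype.ext h2.symm)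
  have hσ : MDifferentiableAt (𝓡∂ 1) (𝓡∂ 1) (segment a b) p.2 :=
    (contMDiff_segment a b).mdifferentiableAt (by simp)
  have hD : mfderiv (bordismModel n) (bordismModel n) (Prod.map f (segment a b)) p =
      (mfderiv (𝓡 n) (𝓡 n) f p.1).prodMap (mfderiv (𝓡∂ 1) (𝓡∂ 1) (segment a b) p.2) :=
    mfderiv_prodMap (hf p.1) hσ
  obtain ⟨e, he, he'⟩ := hfo p.1
  let A₁ : EuclideanSpace ℝ (Fin n) →ₗ[ℝ] EuclideanSpace ℝ (Fin n) :=
    (mfderiv (𝓡 n) (𝓡 n) f p.1).toLinearMap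
  let A₂ : EuclideanSpace ℝ (Fin 1) →ₗ[ℝ] EuclideanSpace ℝ (Fin 1) :=
    (mfderiv (𝓡∂ 1) (𝓡∂ 1) (segment a b) p.2).toLinearMap
  have hA₁ : Function.Injective A₁ := by
    intro x y hxy
    have h1 : ∀ z, A₁ z = e z := fun z => (LinearMap.congr_fun he z).symm
    rw [h1, h1] at hxy
    exact e.injective hxy
  have hA₂ : Function.Injective A₂ := by
    refine (injective_iff_map_eq_zero A₂).mpr fun v hv => ?_
    obtain ⟨r, rfl⟩ := exists_eq_smul_oneTangentSpaceIcc p.2 v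
    have h1 : A₂ (r • (show EuclideanSpace ℝ (Fin 1) from oneTangentSpaceIcc p.2)) =
        r • ((b : ℝ) - a) • (show EuclideanSpace ℝ (Fin 1) from
          oneTangentSpaceIcc (segment a b p.2)) := by
      rw [map_smul]
      exact congrArg (r • ·) (mfderiv_segment a b p.2)
    have h2 := h1.symm.trans hv
    rcases smul_eq_zero.mp h2 with h3 | h3
    · rw [h3]; exact zero_smul ℝ _
    · exact absurd (smul_eq_zero.mp h3) (not_or.mpr ⟨hc, unitInterval_one_ne_zero _⟩)
  let E : BordismSpace n ≃ₗ[ℝ] BordismSpace n :=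
    LinearEquiv.ofInjectiveEndo (A₁.prodMap A₂) (hA₁.prodMap hA₂)
  let o'' : Orientation ℝ (BordismSpace n) (Fin (n + 1)) :=
    Orientation.map (Fin (n + 1)) E (o.cylinder.orientationAt p)
  have hP : PreservesOrientation (V := TangentSpace (bordismModel n) p)
      (V' := TangentSpace (bordismModel n) (f p.1, segment a b p.2))
      (mfderiv (bordismModel n) (bordismModel n) (Prod.map f (segment a b)) p).toLinearMap
        (o.cylinder.orientationAt p) o'' := by
    rw [hD]
    exact ⟨E, rfl, rfl⟩
  refine ⟨o'', hP, ?_⟩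
  have h1 := (o.cylinder_transverse p).map hP
  have h2 : (mfderiv (bordismModel n) (bordismModel n) (Prod.map f (segment a b)) p)
      (cylinderVector p) = ((b : ℝ) - a) • cylinderVector (n := n) (f p.1, segment a b p.2) := by
    rw [hD]
    refine Prod.ext ?_ (mfderiv_segment a b p.2)
    exact (map_zero (mfderiv (𝓡 n) (𝓡 n) f p.1)).trans (smul_zero _).symm
  have h3 : (mfderiv (bordismModel n) (bordismModel n) (Prod.map f (segment a b)) p).toLinearMap ∘ₗ
      cylinderIncl p = cylinderIncl (f p.1, segment a b p.2) ∘ₗ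
        (mfderiv (𝓡 n) (𝓡 n) f p.1).toLinearMap := by
    rw [hD]
    ext u
    refine Prod.ext rfl ?_
    exact map_zero (mfderiv (𝓡∂ 1) (𝓡∂ 1) (segment a b) p.2)
  have h4 : TransverseOriented (((b : ℝ) - a) • cylinderVector (n := n) (f p.1, segment a b p.2))
      (cylinderIncl (f p.1, segment a b p.2) ∘ₗ (mfderiv (𝓡 n) (𝓡 n) f p.1).toLinearMap)
      (o.orientationAt p.1) o'' := by
    rw [← h2, ← h3]
    exact h1
  exact h4.of_comp_right (hfo p.1)

variable [IsManifold (𝓡 n) 1 N]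

theorem OrientationPreserving.prodMap_segment (hf : MDifferentiable (𝓡 n) (𝓡 n) f)
    (hfo : OrientationPreserving o o' f) (hab : a < b) :
    OrientationPreserving o.cylinder o'.cylinder (Prod.map f (segment a b)) := by
  intro p
  obtain ⟨o'', h1, h2⟩ := exists_map_cylinder hf hfo hab.ne p
  have h3 := TransverseOriented.unique (V := BordismSpace n) (U := EuclideanSpace ℝ (Fin n)) (by simp)
    (h2.of_pos_smul (sub_pos.mpr hab)) (o'.cylinder_transverse (f p.1, segment a b p.2))
  rw [h3] at h1
  exact h1

/-- Reversing the direction of `[0, 1]` and the orientation of the base preserves the orientation of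
the cylinder. -/
theorem OrientationPreserving.prodMap_segment_of_gt (hf : MDifferentiable (𝓡 n) (𝓡 n) f)
    (hfo : OrientationPreserving o o'.opp f) (hab : b < a) :
    OrientationPreserving o.cylinder o'.cylinder (Prod.map f (segment a b)) := by
  intro p
  obtain ⟨o'', h1, h2⟩ := exists_map_cylinder hf hfo hab.ne' p
  have h4 := h2.neg
  rw [← neg_smul] at h4
  have h5 : 0 < -((b : ℝ) - a) := by
    rw [neg_sub]; exact sub_pos.mpr hab
  have h6 := h4.of_pos_smul h5
  have h7 : -(o'.opp.orientationAt (f p.1)) = o'.orientationAt (f p.1) :=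
    neg_neg (o'.orientationAt (f p.1))
  rw [h7] at h6
  have h3 := TransverseOriented.unique (V := BordismSpace n) (U := EuclideanSpace ℝ (Fin n)) (by simp)
    h6 (o'.cylinder_transverse (f p.1, segment a b p.2))
  rw [h3] at h1
  exact h1

end CylinderMaps

/-! ### Maps out of the cylinder of a disjoint union -/

section SumProd

/-- A map out of `(M ⊔ M') × N` is smooth if it is smooth on `M × N` and on `M' × N`. -/
theorem ContMDiff.of_sum_prod {𝕜 : Type*} [NontriviallyNormedField 𝕜]
    {E E' E'' H H' H'' : Type*} [NormedAddCommGroup E] [NormedSpace 𝕜 E] [NormedAddCommGroup E']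
    [NormedSpace 𝕜 E'] [NormedAddCommGroup E''] [NormedSpace 𝕜 E''] [TopologicalSpace H]
    [TopologicalSpace H'] [TopologicalSpace H''] {I : ModelWithCorners 𝕜 E H}
    {I' : ModelWithCorners 𝕜 E' H'} {I'' : ModelWithCorners 𝕜 E'' H''} {m : WithTop ℕ∞}
    {M M' N W : Type*} [TopologicalSpace M] [ChartedSpace H M] [TopologicalSpace M']
    [ChartedSpace H M'] [TopologicalSpace N] [ChartedSpace H' N] [TopologicalSpace W]
    [ChartedSpace H'' W] {F : (M ⊕ M') × N → W}
    (h : ContMDiff (I.prod I') I'' m fun p : M × N => F (Sum.inl p.1, p.2))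
    (h' : ContMDiff (I.prod I') I'' m fun p : M' × N => F (Sum.inr p.1, p.2)) :
    ContMDiff (I.prod I') I'' m F := by
  rintro ⟨x | x, t⟩
  · have h1 : ContMDiff I I m (Sum.elim id fun _ => x : M ⊕ M' → M) :=
      contMDiff_id.sumElim contMDiff_const
    -- Near `M × N`, the map `F` factors through a smooth retraction of `M ⊔ M'` onto `M`.
    have h2 := (h.comp (h1.prodMap (contMDiff_id (I := I') (M := N)))) (Sum.inl x, t)
    refine h2.congr_of_eventuallyEq ?_
    have h3 : range (Sum.inl : M → M ⊕ M') ∈ 𝓝 (Sum.inl x) :=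
      isOpen_range_inl.mem_nhds ⟨x, rfl⟩
    filter_upwards [continuousAt_fst.preimage_mem_nhds (x := ((Sum.inl x, t) : (M ⊕ M') × N)) h3]
    rintro ⟨_, s⟩ ⟨y, rfl⟩
    rfl
  · have h1 : ContMDiff I I m (Sum.elim (fun _ => x) id : M ⊕ M' → M') :=
      contMDiff_const.sumElim contMDiff_id
    have h2 := (h'.comp (h1.prodMap (contMDiff_id (I := I') (M := N)))) (Sum.inr x, t)
    refine h2.congr_of_eventuallyEq ?_
    have h3 : range (Sum.inr : M' → M ⊕ M') ∈ 𝓝 (Sum.inr x) :=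
      isOpen_range_inr.mem_nhds ⟨x, rfl⟩
    filter_upwards [continuousAt_fst.preimage_mem_nhds (x := ((Sum.inr x, t) : (M ⊕ M') × N)) h3]
    rintro ⟨_, s⟩ ⟨y, rfl⟩
    rfl

/-- If `f` and `g ∘ f` preserve orientations, so does `g` at the points in the range of `f`. -/
theorem OrientationPreserving.of_comp {E H : Type*} [NormedAddCommGroup E] [NormedSpace ℝ E]
    [TopologicalSpace H] {I : ModelWithCorners ℝ E H} {d : ℕ}
    {M M' M'' : Type*} [TopologicalSpace M] [ChartedSpace H M] [TopologicalSpace M']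
    [ChartedSpace H M'] [TopologicalSpace M''] [ChartedSpace H M'']
    {o : ManifoldOrientation I d M} {o' : ManifoldOrientation I d M'}
    {o'' : ManifoldOrientation I d M''} {f : M → M'} {g : M' → M''}
    (hf : OrientationPreserving o o' f) (hgf : OrientationPreserving o o'' (g ∘ f))
    (hg' : MDifferentiable I I g) (hf' : MDifferentiable I I f) (x : M) :
    PreservesOrientation (mfderiv I I g (f x)).toLinearMap (o'.orientationAt (f x))
      (o''.orientationAt (g (f x))) := by
  have h1 := hgf x
  rw [mfderiv_comp x (hg' (f x)) (hf' x), ContinuousLinearMap.toLinearMap_comp] at h1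
  exact (hf x).of_comp h1

variable {n : ℕ} {M : Type*} [TopologicalSpace M] [ChartedSpace (EuclideanSpace ℝ (Fin n)) M]
  [IsManifold (𝓡 n) 1 M]
  {N : Type*} [TopologicalSpace N] [ChartedSpace (EuclideanSpace ℝ (Fin n)) N]
  [IsManifold (𝓡 n) 1 N]
  {W : Type*} [TopologicalSpace W] [ChartedSpace (BordismHalfSpace n) W]
  {o : ManifoldOrientation (𝓡 n) n M} {o' : ManifoldOrientation (𝓡 n) n N}
  {oW : ManifoldOrientation (bordismModel n) (n + 1) W}

/-- A map out of `(M ⊔ N) × [0, 1]` preserves orientations if it does so on `M × [0, 1]` and on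
`N × [0, 1]`. -/
theorem OrientationPreserving.of_sum_cylinder {F : (M ⊕ N) × unitInterval → W}
    (hF : MDifferentiable (bordismModel n) (bordismModel n) F)
    (h : OrientationPreserving o.cylinder oW fun p : M × unitInterval => F (Sum.inl p.1, p.2))
    (h' : OrientationPreserving o'.cylinder oW
      fun p : N × unitInterval => F (Sum.inr p.1, p.2)) :
    OrientationPreserving (o.sum o').cylinder oW F := by
  -- As `segment 0 1` is the identity, the inclusions of the summands are products with a segment.
  have hs : unitInterval.segment 0 1 = _root_.id := by
    ext t; simp [unitInterval.coe_segment]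
  have hl := (OrientationPreserving.inl (o := o) (o' := o')).prodMap_segment
    (ContMDiff.inl.mdifferentiable (n := 1) one_ne_zero) (zero_lt_one (α := unitInterval))
  have hr := (OrientationPreserving.inr (o := o) (o' := o')).prodMap_segment
    (ContMDiff.inr.mdifferentiable (n := 1) one_ne_zero) (zero_lt_one (α := unitInterval))
  rw [hs] at hl hr
  have hl' : MDifferentiable (bordismModel n) (bordismModel n)
      (Prod.map Sum.inl _root_.id : M × unitInterval → (M ⊕ N) × unitInterval) :=
    (ContMDiff.inl.prodMap contMDiff_id).mdifferentiable (n := 1) one_ne_zero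
  have hr' : MDifferentiable (bordismModel n) (bordismModel n)
      (Prod.map Sum.inr _root_.id : N × unitInterval → (M ⊕ N) × unitInterval) :=
    (ContMDiff.inr.prodMap contMDiff_id).mdifferentiable (n := 1) one_ne_zero
  rintro ⟨x | x, t⟩
  · exact hl.of_comp h hF hl' (x, t)
  · exact hr.of_comp h' hF hr' (x, t)

end SumProd

/-! ### Gluing -/

section Gluing

variable {n : ℕ} {L M N L' M' N' : ClosedManifold.{u} n}

/-- Half of the description of the intersection in the definition of a gluing is automatic. -/
theorem Bordism.IsGluing.of_subset {B : Bordism L M} {B' : Bordism M N} {C : Bordism L N}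
    (i : B.carrier → C.carrier) (j : B'.carrier → C.carrier)
    (hi : ContMDiff (bordismModel n) (bordismModel n) ∞ i)
    (hj : ContMDiff (bordismModel n) (bordismModel n) ∞ j)
    (hio : OrientationPreserving B.orientation C.orientation i)
    (hjo : OrientationPreserving B'.orientation C.orientation j)
    (hi' : Function.Injective i) (hj' : Function.Injective j) (hij : i ∘ B.out = j ∘ B'.inc)
    (hun : range i ∪ range j = univ) (hint : range i ∩ range j ⊆ range (i ∘ B.out))
    (hinc : i ∘ B.inc = C.inc) (hout : j ∘ B'.out = C.out) : B.IsGluing B' C :=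
  ⟨i, j, hi, hj, hio, hjo, hi', hj', hij, hun,
    hint.antisymm (subset_inter (range_comp_subset_range _ _)
      (hij ▸ range_comp_subset_range _ _)), hinc, hout⟩

/-- The disjoint union of two gluings is a gluing. -/
theorem Bordism.IsGluing.sum {B : Bordism L M} {B' : Bordism M N} {C : Bordism L N}
    {D : Bordism L' M'} {D' : Bordism M' N'} {E : Bordism L' N'} (h : B.IsGluing B' C)
    (h' : D.IsGluing D' E) : (B.sum D).IsGluing (B'.sum D') (C.sum E) := by
  obtain ⟨i, j, hi, hj, hio, hjo, hi', hj', hij, hun, hint, hinc, hout⟩ := h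
  obtain ⟨k, l, hk, hl, hko, hlo, hk', hl', hkl, hun', hint', hinc', hout'⟩ := h'
  have key {X X' Y Y' : Type u} [TopologicalSpace X] [TopologicalSpace X'] [TopologicalSpace Y]
      [TopologicalSpace Y'] [ChartedSpace (BordismHalfSpace n) X]
      [ChartedSpace (BordismHalfSpace n) X'] [ChartedSpace (BordismHalfSpace n) Y]
      [ChartedSpace (BordismHalfSpace n) Y'] [IsManifold (bordismModel n) 1 X]
      [IsManifold (bordismModel n) 1 X'] [IsManifold (bordismModel n) 1 Y]
      [IsManifold (bordismModel n) 1 Y']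
      {oX : ManifoldOrientation (bordismModel n) (n + 1) X}
      {oX' : ManifoldOrientation (bordismModel n) (n + 1) X'}
      {oY : ManifoldOrientation (bordismModel n) (n + 1) Y}
      {oY' : ManifoldOrientation (bordismModel n) (n + 1) Y'} {f : X → Y} {g : X' → Y'}
      (hf : ContMDiff (bordismModel n) (bordismModel n) ∞ f)
      (hg : ContMDiff (bordismModel n) (bordismModel n) ∞ g)
      (hfo : OrientationPreserving oX oY f) (hgo : OrientationPreserving oX' oY' g) :
      OrientationPreserving (oX.sum oX') (oY.sum oY') (Sum.map f g) :=
    .of_sum ((hf.sumMap hg).mdifferentiable (by simp))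
      (OrientationPreserving.inl.comp hfo (ContMDiff.inl.mdifferentiable (n := 1) one_ne_zero)
        (hf.mdifferentiable (by simp)))
      (OrientationPreserving.inr.comp hgo (ContMDiff.inr.mdifferentiable (n := 1) one_ne_zero)
        (hg.mdifferentiable (by simp)))
  refine .of_subset (Sum.map i k) (Sum.map j l) (hi.sumMap hk) (hj.sumMap hl) (key hi hk hio hko)
    (key hj hl hjo hlo) (hi'.sumMap hk') (hj'.sumMap hl') ?_ ?_ ?_ ?_ ?_
  · funext y
    rcases y with y | y
    · exact congrArg Sum.inl (congrFun hij y)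
    · exact congrArg Sum.inr (congrFun hkl y)
  · refine eq_univ_of_forall ?_
    rintro (c | c)
    · rcases hun.ge (mem_univ c) with ⟨x, rfl⟩ | ⟨x, rfl⟩
      · exact Or.inl ⟨Sum.inl x, rfl⟩
      · exact Or.inr ⟨Sum.inl x, rfl⟩
    · rcases hun'.ge (mem_univ c) with ⟨x, rfl⟩ | ⟨x, rfl⟩
      · exact Or.inl ⟨Sum.inr x, rfl⟩
      · exact Or.inr ⟨Sum.inr x, rfl⟩
  · rintro _ ⟨⟨x | x, rfl⟩, ⟨y | y, hxy⟩⟩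
    · obtain ⟨z, hz⟩ := hint.le ⟨⟨x, rfl⟩, ⟨y, Sum.inl_injective hxy⟩⟩
      exact ⟨Sum.inl z, congrArg Sum.inl hz⟩
    · cases hxy
    · cases hxy
    · obtain ⟨z, hz⟩ := hint'.le ⟨⟨x, rfl⟩, ⟨y, Sum.inr_injective hxy⟩⟩
      exact ⟨Sum.inr z, congrArg Sum.inr hz⟩
  · funext y
    rcases y with y | y
    · exact congrArg Sum.inl (congrFun hinc y)
    · exact congrArg Sum.inr (congrFun hinc' y)
  · funext y
    rcases y with y | y
    · exact congrArg Sum.inl (congrFun hout y)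
    · exact congrArg Sum.inr (congrFun hout' y)

/-- In a gluing, the second bordism can be replaced by an equivalent one. -/
theorem Bordism.IsGluing.congr_right {B : Bordism L M} {B' B'' : Bordism M N} {C : Bordism L N}
    (h : B.IsGluing B' C) (h' : B''.Equivalent B') : B.IsGluing B'' C := by
  obtain ⟨i, j, hi, hj, hio, hjo, hi', hj', hij, hun, hint, hinc, hout⟩ := h
  obtain ⟨φ, hφ, hφi, hφo⟩ := h'
  refine ⟨i, j ∘ φ, hi, hj.comp φ.contMDiff, hio, hjo.comp hφ (hj.mdifferentiable (by simp))
    (φ.mdifferentiable (by simp)), hi', hj'.comp φ.injective, ?_, ?_, ?_, hinc, ?_⟩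
  · rw [hij, ← hφi]; rfl
  · rw [(show Function.Surjective φ from φ.surjective).range_comp, hun]
  · rw [(show Function.Surjective φ from φ.surjective).range_comp, hint]
  · rw [← hout, ← hφo]; rfl

/-- The cylinder of a disjoint union is the disjoint union of the cylinders. -/
theorem Bordism.equivalent_cylinder_sum (M N : ClosedManifold.{u} n) :
    (Bordism.mappingCylinder (.refl (M.sum N))).Equivalent
      ((Bordism.mappingCylinder (.refl M)).sum (Bordism.mappingCylinder (.refl N))) := by
  have h1 : ContMDiff (bordismModel n) (bordismModel n) ∞
      (Equiv.sumProdDistrib M.carrier N.carrier unitInterval) :=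
    ContMDiff.of_sum_prod (I := 𝓡 n) (I' := 𝓡∂ 1) ContMDiff.inl ContMDiff.inr
  have h2 : ContMDiff (bordismModel n) (bordismModel n) ∞
      (Equiv.sumProdDistrib M.carrier N.carrier unitInterval).symm :=
    (ContMDiff.inl.prodMap contMDiff_id).sumElim (ContMDiff.inr.prodMap contMDiff_id)
  refine ⟨⟨Equiv.sumProdDistrib M.carrier N.carrier unitInterval, h1, h2⟩, ?_, ?_, ?_⟩
  · exact OrientationPreserving.of_sum_cylinder (o := M.orientation) (o' := N.orientation)
      (h1.mdifferentiable (by simp)) OrientationPreserving.inl OrientationPreserving.inr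
  · funext x
    rcases x with x | x <;> rfl
  · funext x
    rcases x with x | x <;> rfl

/-- The bordism `B` with its outgoing boundary reparametrized by a diffeomorphism. -/
noncomputable def Bordism.mapOut (B : Bordism L M) (f : OrientedDiffeo M N) : Bordism L N where
  carrier := B.carrier
  orientation := B.orientation
  inc := B.inc
  out := B.out ∘ f.toDiffeo.symm
  inc_smooth := B.inc_smooth
  out_smooth := B.out_smooth.comp f.toDiffeo.symm.contMDiff
  injective := by
    have h := B.injective.comp
      (Function.injective_id.sumMap f.toDiffeo.symm.injective : Function.Injective
        (Sum.map id f.toDiffeo.symm : L.carrier ⊕ N.carrier → L.carrier ⊕ M.carrier))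
    rwa [Sum.elim_comp_map] at h
  range_eq := by
    rw [← B.range_eq, Sum.elim_range, Sum.elim_range,
      (show Function.Surjective f.toDiffeo.symm from f.toDiffeo.symm.surjective).range_comp]
  inc_oriented := B.inc_oriented
  out_oriented y := by
    obtain ⟨v, hv, h⟩ := B.out_oriented (f.toDiffeo.symm y)
    refine ⟨v, hv, ?_⟩
    have h1 : mfderiv (𝓡 n) (bordismModel n) (B.out ∘ f.toDiffeo.symm) y
        = (mfderiv (𝓡 n) (bordismModel n) B.out (f.toDiffeo.symm y)).comp
          (mfderiv (𝓡 n) (𝓡 n) f.toDiffeo.symm y) :=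
      mfderiv_comp y (B.out_smooth.mdifferentiableAt (by simp))
        (f.toDiffeo.symm.contMDiff.mdifferentiableAt (by simp))
    rw [h1, ContinuousLinearMap.toLinearMap_comp]
    exact h.comp_right (f.symm.oriented y)

/-- If gluing a cylinder to the outgoing end of `B` gives `B` (that is, if this end has a
collar), then gluing the mapping cylinder of `f` reparametrizes this end by `f`. -/
theorem Bordism.IsGluing.mapOut {B : Bordism L M} (f : OrientedDiffeo M N)
    (h : B.IsGluing (.mappingCylinder (.refl M)) B) :
    B.IsGluing (.mappingCylinder f) (B.mapOut f) := by
  obtain ⟨i, j, hi, hj, hio, hjo, hi', hj', hij, hun, hint, hinc, hout⟩ := h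
  exact ⟨i, j, hi, hj, hio, hjo, hi', hj', hij, hun, hint, hinc,
    funext fun y => congrFun hout (f.toDiffeo.symm y)⟩

end Gluing

/-! ### The coevaluation bordism -/

section Coevaluation

variable {n : ℕ}

/-- The cylinder `M × [0, 1]` as a bordism from `∅` to `M̄ ⊔ M`. With the orientation of the
cylinder, the end `M × {0}` has to be the one that is identified with `M̄`. -/
noncomputable def Bordism.coevaluation (M : ClosedManifold.{u} n) :
    Bordism (ClosedManifold.empty n) (M.opp.sum M) where
  carrier := M.carrier × unitInterval
  orientation := M.orientation.cylinder
  inc := isEmptyElim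
  out := Sum.elim (fun x => (x, 0)) (fun x => (x, 1))
  inc_smooth y := isEmptyElim y
  out_smooth := (contMDiff_id.prodMk contMDiff_const).sumElim (contMDiff_id.prodMk contMDiff_const)
  injective := by
    rintro (x | (x | x)) (x' | (x' | x')) h <;>
      first
      | exact isEmptyElim x
      | exact isEmptyElim x'
      | exact congrArg (fun y => Sum.inr (Sum.inl y)) (congrArg Prod.fst h)
      | exact congrArg (fun y => Sum.inr (Sum.inr y)) (congrArg Prod.fst h)
      | exact absurd (congrArg Prod.snd h) zero_ne_one
      | exact absurd (congrArg Prod.snd h) one_ne_zero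
  range_eq := by
    rw [boundary_cylinder]
    ext ⟨x, t⟩
    constructor
    · rintro ⟨y | (y | y), h⟩
      · exact isEmptyElim y
      · exact Or.inl (congrArg Prod.snd h).symm
      · exact Or.inr (congrArg Prod.snd h).symm
    · rintro (h | h)
      · exact ⟨Sum.inr (Sum.inl x), Prod.ext rfl h.symm⟩
      · exact ⟨Sum.inr (Sum.inr x), Prod.ext rfl h.symm⟩
  inc_oriented y := isEmptyElim y
  out_oriented := by
    rintro ((x : M.carrier) | x)
    · refine ⟨cylinderVector (x, 0), cylinderVector_zero_inward (M := M.carrier) x, ?_⟩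
      have h := (M.orientation.cylinder_transverse (x, 0)).neg
      rw [← mfderiv_cylinderIncl] at h
      exact TransverseOriented.boundary_reparam (i := (Sum.inl : M.carrier → M.carrier ⊕ M.carrier))
        (f' := Sum.elim (fun x : M.carrier => (x, (0 : unitInterval))) (fun x => (x, 1)))
        (ContMDiff.inl.mdifferentiableAt (n := 1) one_ne_zero)
        (((contMDiff_id.prodMk contMDiff_const).sumElim
          (contMDiff_id.prodMk contMDiff_const)).mdifferentiableAt (n := ∞) (by simp))
        (ManifoldOrientation.preserves_inl (M' := M.carrier) x (-M.orientation.orientationAt x)) h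
    · refine ⟨-cylinderVector (M := M.carrier) (x, 1),
        cylinderVector_one_inward (M := M.carrier) x, ?_⟩
      have h := M.orientation.cylinder_transverse (x, 1)
      rw [← mfderiv_cylinderIncl, ← neg_neg (cylinderVector (M := M.carrier) (x, 1))] at h
      exact TransverseOriented.boundary_reparam (i := (Sum.inr : M.carrier → M.carrier ⊕ M.carrier))
        (f' := Sum.elim (fun x : M.carrier => (x, (0 : unitInterval))) (fun x => (x, 1)))
        (ContMDiff.inr.mdifferentiableAt (n := 1) one_ne_zero)
        (((contMDiff_id.prodMk contMDiff_const).sumElim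
          (contMDiff_id.prodMk contMDiff_const)).mdifferentiableAt (n := ∞) (by simp))
        (ManifoldOrientation.preserves_inr (M' := M.carrier) x (M.orientation.orientationAt x)) h

end Coevaluation

/-! ### Decomposing a cylinder into pieces -/

section PiecesOfACylinder

variable {X Y : Type*}

theorem injective_prodMap_segment {f : X → Y} (hf : Function.Injective f) {a b : unitInterval}
    (h : a ≠ b) : Function.Injective (Prod.map f (unitInterval.segment a b)) :=
  hf.prodMap (unitInterval.segment_injective h)

theorem injective_sumElim_prodMap {f : X → Y} (hf : Function.Injective f)
    {σ τ : unitInterval → unitInterval} (hσ : Function.Injective σ) (hτ : Function.Injective τ)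
    (h : Disjoint (range σ) (range τ)) :
    Function.Injective (Sum.elim (Prod.map f σ) (Prod.map f τ)) := by
  refine (hf.prodMap hσ).sumElim (hf.prodMap hτ) fun p q hpq => ?_
  exact disjoint_left.mp h ⟨p.2, rfl⟩ ⟨q.2, (congrArg Prod.snd hpq).symm⟩

theorem range_sumElim_prodMap {f : X → Y} (hf : Function.Surjective f)
    {σ τ : unitInterval → unitInterval} :
    range (Sum.elim (Prod.map f σ) (Prod.map f τ)) = univ ×ˢ (range σ ∪ range τ) := by
  rw [Sum.elim_range, range_prodMap, range_prodMap, hf.range_eq, prod_union]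

end PiecesOfACylinder

section Intervals

variable {α : Type*} [LinearOrder α] [BoundedOrder α] {a b c : α}

theorem Icc_union_Icc_union_alternate (a b c : α) :
    (Icc ⊥ a ∪ Icc b c) ∪ (Icc a b ∪ Icc c ⊤) = univ := by
  refine eq_univ_of_forall fun t => ?_
  rcases le_total t a with h | h
  · exact Or.inl (Or.inl ⟨bot_le, h⟩)
  · rcases le_total t b with h' | h'
    · exact Or.inr (Or.inl ⟨h, h'⟩)
    · rcases le_total t c with h'' | h''
      · exact Or.inl (Or.inr ⟨h', h''⟩)
      · exact Or.inr (Or.inr ⟨h'', le_top⟩)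

theorem Icc_union_Icc_inter_alternate (hab : a < b) (hbc : b < c) :
    (Icc ⊥ a ∪ Icc b c) ∩ (Icc a b ∪ Icc c ⊤) ⊆ {a, b, c} := by
  rintro t ⟨⟨_, h1⟩ | ⟨h1, h2⟩, ⟨h3, h4⟩ | ⟨h3, _⟩⟩
  · exact Or.inl (le_antisymm h1 h3)
  · exact absurd (h3.trans h1) (hab.trans hbc).not_ge
  · exact Or.inr (Or.inl (le_antisymm h4 h1))
  · exact Or.inr (Or.inr (le_antisymm h2 h3))

end Intervals

/-! ### Collars and the zigzag gluings -/

section Zigzag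

variable {n : ℕ}

open unitInterval (segment contMDiff_segment range_segment range_segment_of_gt segment_injective
  segment_zero segment_one)

/-- The cylinder of `M` has a collar. -/
theorem Bordism.isGluing_cylinder (M : ClosedManifold.{u} n) :
    (Bordism.mappingCylinder (.refl M)).IsGluing (.mappingCylinder (.refl M))
      (.mappingCylinder (.refl M)) := by
  obtain ⟨a, ha0, ha1⟩ := exists_between (zero_lt_one (α := unitInterval))
  have hd : MDifferentiable (𝓡 n) (𝓡 n) (fun x : M.carrier => x) :=
    contMDiff_id.mdifferentiable (n := 1) one_ne_zero
  refine .of_subset (Prod.map (fun x : M.carrier => x) (segment 0 a))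
    (Prod.map (fun x : M.carrier => x) (segment a 1))
    (contMDiff_id.prodMap (contMDiff_segment _ _)) (contMDiff_id.prodMap (contMDiff_segment _ _))
    (OrientationPreserving.id.prodMap_segment hd ha0)
    (OrientationPreserving.id.prodMap_segment hd ha1)
    (injective_prodMap_segment Function.injective_id ha0.ne)
    (injective_prodMap_segment Function.injective_id ha1.ne) ?_ ?_ ?_ ?_ ?_
  · funext x
    exact Prod.ext rfl ((segment_one 0 a).trans (segment_zero a 1).symm)
  · refine eq_univ_of_forall ?_
    rintro ⟨x, t⟩
    rcases le_total t a with h | h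
    · obtain ⟨s, hs⟩ := (range_segment ha0).ge ⟨t.2.1, h⟩
      exact Or.inl ⟨(x, s), Prod.ext rfl hs⟩
    · obtain ⟨s, hs⟩ := (range_segment ha1).ge ⟨h, t.2.2⟩
      exact Or.inr ⟨(x, s), Prod.ext rfl hs⟩
  · rintro _ ⟨⟨⟨x, s⟩, rfl⟩, ⟨⟨y, t⟩, hxy⟩⟩
    have h1 : segment a 1 t = segment 0 a s := congrArg Prod.snd hxy
    have h2 := (range_segment ha0).le ⟨s, rfl⟩
    have h3 := (range_segment ha1).le ⟨t, rfl⟩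
    rw [h1] at h3
    exact ⟨x, Prod.ext rfl ((segment_one 0 a).trans (h3.1.antisymm h2.2))⟩
  · funext x
    exact Prod.ext rfl (segment_zero 0 a)
  · funext x
    exact Prod.ext rfl (segment_one a 1)

/-- The outgoing end of the coevaluation bordism has a collar. -/
theorem Bordism.isGluing_coevaluation_cylinder (M : ClosedManifold.{u} n) :
    (Bordism.coevaluation M).IsGluing (.mappingCylinder (.refl (M.opp.sum M)))
      (.coevaluation M) := by
  obtain ⟨a, ha0, ha1⟩ := exists_between (zero_lt_one (α := unitInterval))
  obtain ⟨b, hab, hb1⟩ := exists_between ha1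
  have hd : MDifferentiable (𝓡 n) (𝓡 n) (fun x : M.carrier => x) :=
    contMDiff_id.mdifferentiable (n := 1) one_ne_zero
  -- The collars `M × [0, a]` of the end `M̄`, traversed backwards, and `M × [b, 1]` of the end `M`.
  let j : (M.carrier ⊕ M.carrier) × unitInterval → M.carrier × unitInterval := fun p =>
    Sum.elim (fun x => (x, segment a 0 p.2)) (fun x => (x, segment b 1 p.2)) p.1
  have hj : ContMDiff (bordismModel n) (bordismModel n) ∞ j :=
    .of_sum_prod (contMDiff_id.prodMap (contMDiff_segment a 0))
      (contMDiff_id.prodMap (contMDiff_segment b 1))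
  have hj0 := range_segment_of_gt ha0
  have hj1 := range_segment hb1
  refine .of_subset (Prod.map (fun x : M.carrier => x) (segment a b)) j
    (contMDiff_id.prodMap (contMDiff_segment _ _)) hj
    (OrientationPreserving.id.prodMap_segment hd hab)
    (.of_sum_cylinder (o := M.orientation.opp) (o' := M.orientation)
      (hj.mdifferentiable (by simp)) (OrientationPreserving.id.prodMap_segment_of_gt hd ha0)
      (OrientationPreserving.id.prodMap_segment hd hb1))
    (injective_prodMap_segment Function.injective_id hab.ne) ?_ ?_ ?_ ?_ ?_ ?_
  · rintro ⟨x | x, s⟩ ⟨y | y, t⟩ h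
    · have h1 : x = y := congrArg Prod.fst h
      have h2 : s = t := segment_injective ha0.ne' (congrArg Prod.snd h : segment a 0 s = segment a 0 t)
      exact Prod.ext (congrArg Sum.inl h1) h2
    · have h1 : segment a 0 s = segment b 1 t := congrArg Prod.snd h
      exact absurd ((hj1.le ⟨t, h1.symm⟩).1.trans (hj0.le ⟨s, rfl⟩).2) hab.not_ge
    · have h1 : segment b 1 s = segment a 0 t := congrArg Prod.snd h
      exact absurd ((hj1.le ⟨s, h1⟩).1.trans (hj0.le ⟨t, rfl⟩).2) hab.not_ge
    · have h1 : x = y := congrArg Prod.fst h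
      have h2 : s = t := segment_injective hb1.ne (congrArg Prod.snd h : segment b 1 s = segment b 1 t)
      exact Prod.ext (congrArg Sum.inr h1) h2
  · funext x
    rcases x with x | x
    · exact Prod.ext rfl ((segment_zero a b).trans (segment_zero a 0).symm)
    · exact Prod.ext rfl ((segment_one a b).trans (segment_zero b 1).symm)
  · refine eq_univ_of_forall ?_
    rintro ⟨x, t⟩
    rcases le_total t a with h | h
    · obtain ⟨s, hs⟩ := hj0.ge ⟨t.2.1, h⟩
      exact Or.inr ⟨(Sum.inl x, s), Prod.ext rfl hs⟩
    · rcases le_total t b with h' | h'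
      · obtain ⟨s, hs⟩ := (range_segment hab).ge ⟨h, h'⟩
        exact Or.inl ⟨(x, s), Prod.ext rfl hs⟩
      · obtain ⟨s, hs⟩ := hj1.ge ⟨h', t.2.2⟩
        exact Or.inr ⟨(Sum.inr x, s), Prod.ext rfl hs⟩
  · rintro _ ⟨⟨⟨x, s⟩, rfl⟩, ⟨⟨y | y, t⟩, hxy⟩⟩
    · have h1 : segment a 0 t = segment a b s := congrArg Prod.snd hxy
      have h2 := hj0.le ⟨t, h1⟩
      have h3 := (range_segment hab).le ⟨s, rfl⟩
      exact ⟨Sum.inl x, Prod.ext rfl ((segment_zero a b).trans (h3.1.antisymm h2.2))⟩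
    · have h1 : segment b 1 t = segment a b s := congrArg Prod.snd hxy
      have h2 := hj1.le ⟨t, h1⟩
      have h3 := (range_segment hab).le ⟨s, rfl⟩
      exact ⟨Sum.inr x, Prod.ext rfl ((segment_one a b).trans (h2.1.antisymm h3.2))⟩
  · exact funext fun x => isEmptyElim x
  · funext x
    rcases x with x | x
    · exact Prod.ext rfl (segment_one a 0)
    · exact Prod.ext rfl (segment_one b 1)

/-- Along `M × [0, 1]`, the four pieces of this gluing are, in order, the cylinder of `M`, the
evaluation, the coevaluation, and again the cylinder of `M`. -/
theorem Bordism.isGluing_zigzag (M : ClosedManifold.{u} n) :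
    (((Bordism.mappingCylinder (.refl M)).sum (.coevaluation M)).mapOut
        (OrientedDiffeo.sumAssoc M M.opp M).symm).IsGluing
      ((Bordism.evaluation M).sum (.mappingCylinder (.refl M)))
      (.mappingCylinder ((OrientedDiffeo.sumEmpty M).trans (OrientedDiffeo.emptySum M).symm)) := by
  obtain ⟨a, ha0, ha1⟩ := exists_between (zero_lt_one (α := unitInterval))
  obtain ⟨b, hab, hb1⟩ := exists_between ha1
  obtain ⟨c, hbc, hc1⟩ := exists_between hb1
  let f : M.carrier → M.carrier ⊕ (ClosedManifold.empty.{u} n).carrier := Sum.inl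
  have hf : ContMDiff (𝓡 n) (𝓡 n) ∞ f := ContMDiff.inl
  have hfo : OrientationPreserving M.orientation
      (M.orientation.sum (ClosedManifold.empty n).orientation) f := .inl
  have hf' : Function.Injective f := Sum.inl_injective
  have hf'' : Function.Surjective f := by
    rintro (x | x)
    · exact ⟨x, rfl⟩
    · exact isEmptyElim x
  have hd : MDifferentiable (𝓡 n) (𝓡 n) f := hf.mdifferentiable (by simp)
  have hs {a b : unitInterval} : ContMDiff (bordismModel n) (bordismModel n) ∞
      (Prod.map f (segment a b)) := hf.prodMap (contMDiff_segment a b)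
  have hi := (hs (a := 0) (b := a)).sumElim (hs (a := b) (b := c))
  have hj := (hs (a := a) (b := b)).sumElim (hs (a := c) (b := 1))
  refine .of_subset (Sum.elim (Prod.map f (segment 0 a)) (Prod.map f (segment b c)))
    (Sum.elim (Prod.map f (segment a b)) (Prod.map f (segment c 1))) hi hj
    (.of_sum (hi.mdifferentiable (by simp)) (hfo.prodMap_segment hd ha0)
      (hfo.prodMap_segment hd hbc))
    (.of_sum (hj.mdifferentiable (by simp)) (hfo.prodMap_segment hd hab)
      (hfo.prodMap_segment hd hc1))
    (injective_sumElim_prodMap hf' (segment_injective ha0.ne) (segment_injective hbc.ne) ?_)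
    (injective_sumElim_prodMap hf' (segment_injective hab.ne) (segment_injective hc1.ne) ?_)
    ?_ ?_ ?_ ?_ ?_
  · rw [range_segment ha0, range_segment hbc]
    exact disjoint_left.mpr fun t h h' => absurd (h'.1.trans h.2) hab.not_ge
  · rw [range_segment hab, range_segment hc1]
    exact disjoint_left.mpr fun t h h' => absurd (h'.1.trans h.2) hbc.not_ge
  · funext x
    rcases x with (x | x) | x
    · exact Prod.ext rfl ((segment_one 0 a).trans (segment_zero a b).symm)
    · exact Prod.ext rfl ((segment_zero b c).trans (segment_one a b).symm)
    · exact Prod.ext rfl ((segment_one b c).trans (segment_zero c 1).symm)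
  · refine (congrArg₂ (· ∪ ·) (range_sumElim_prodMap hf'') (range_sumElim_prodMap hf'')).trans ?_
    rw [range_segment ha0, range_segment hbc, range_segment hab, range_segment hc1, ← prod_union]
    exact (congrArg (univ ×ˢ ·) (Icc_union_Icc_union_alternate a b c)).trans univ_prod_univ
  · refine (congrArg₂ (· ∩ ·) (range_sumElim_prodMap hf'') (range_sumElim_prodMap hf'')).le.trans ?_
    rw [range_segment ha0, range_segment hbc, range_segment hab, range_segment hc1]
    rintro ⟨s, t⟩ ⟨⟨_, h1⟩, ⟨_, h2⟩⟩
    obtain ⟨x, rfl⟩ := hf'' s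
    rcases Icc_union_Icc_inter_alternate hab hbc ⟨h1, h2⟩ with h | h | h
    · exact ⟨Sum.inl (Sum.inl x), Prod.ext rfl ((segment_one 0 a).trans h.symm)⟩
    · exact ⟨Sum.inl (Sum.inr x), Prod.ext rfl ((segment_zero b c).trans h.symm)⟩
    · exact ⟨Sum.inr x, Prod.ext rfl ((segment_one b c).trans h.symm)⟩
  · funext x
    rcases x with x | x
    · exact Prod.ext rfl (segment_zero 0 a)
    · exact isEmptyElim x
  · funext x
    rcases x with x | x
    · exact isEmptyElim x
    · exact Prod.ext rfl (segment_one c 1)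

/-- Along `M̄ × [0, 1]`, the four pieces of this gluing are, in order, the cylinder of `M̄`, the
evaluation and the coevaluation, both traversed backwards, and again the cylinder of `M̄`. -/
theorem Bordism.isGluing_zigzag_opp (M : ClosedManifold.{u} n) :
    (((Bordism.coevaluation M).sum (.mappingCylinder (.refl M.opp))).mapOut
        (OrientedDiffeo.sumAssoc M.opp M M.opp)).IsGluing
      ((Bordism.mappingCylinder (.refl M.opp)).sum (.evaluation M))
      (.mappingCylinder
        ((OrientedDiffeo.emptySum M.opp).trans (OrientedDiffeo.sumEmpty M.opp).symm)) := by
  obtain ⟨a, ha0, ha1⟩ := exists_between (zero_lt_one (α := unitInterval))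
  obtain ⟨b, hab, hb1⟩ := exists_between ha1
  obtain ⟨c, hbc, hc1⟩ := exists_between hb1
  let f : M.carrier → (ClosedManifold.empty.{u} n).carrier ⊕ M.carrier := Sum.inr
  let o' := (ClosedManifold.empty n).orientation.sum M.orientation.opp
  have hf : ContMDiff (𝓡 n) (𝓡 n) ∞ f := ContMDiff.inr
  have hfo : OrientationPreserving M.orientation.opp o' f := .inr
  have hfo' : OrientationPreserving M.orientation o'.opp f := fun x =>
    neg_neg (M.orientation.orientationAt x) ▸ (hfo x).neg
  have hf' : Function.Injective f := Sum.inr_injective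
  have hf'' : Function.Surjective f := by
    rintro (x | x)
    · exact isEmptyElim x
    · exact ⟨x, rfl⟩
  have hd : MDifferentiable (𝓡 n) (𝓡 n) f := hf.mdifferentiable (by simp)
  have hs {a b : unitInterval} : ContMDiff (bordismModel n) (bordismModel n) ∞
      (Prod.map f (segment a b)) := hf.prodMap (contMDiff_segment a b)
  have hi := (hs (a := c) (b := b)).sumElim (hs (a := 0) (b := a))
  have hj := (hs (a := c) (b := 1)).sumElim (hs (a := b) (b := a))
  refine .of_subset (Sum.elim (Prod.map f (segment c b)) (Prod.map f (segment 0 a)))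
    (Sum.elim (Prod.map f (segment c 1)) (Prod.map f (segment b a))) hi hj
    (.of_sum (o' := M.orientation.opp.cylinder) (hi.mdifferentiable (by simp))
      (hfo'.prodMap_segment_of_gt hd hbc) (hfo.prodMap_segment hd ha0))
    (.of_sum (o' := M.orientation.cylinder) (hj.mdifferentiable (by simp))
      (hfo.prodMap_segment hd hc1) (hfo'.prodMap_segment_of_gt hd hab))
    (injective_sumElim_prodMap hf' (segment_injective hbc.ne') (segment_injective ha0.ne) ?_)
    (injective_sumElim_prodMap hf' (segment_injective hc1.ne) (segment_injective hab.ne') ?_)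
    ?_ ?_ ?_ ?_ ?_
  · rw [range_segment ha0, range_segment_of_gt hbc]
    exact disjoint_left.mpr fun t h h' => absurd (h.1.trans h'.2) hab.not_ge
  · rw [range_segment_of_gt hab, range_segment hc1]
    exact disjoint_left.mpr fun t h h' => absurd (h.1.trans h'.2) hbc.not_ge
  · funext x
    rcases x with x | x | x
    · exact Prod.ext rfl ((segment_zero c b).trans (segment_zero c 1).symm)
    · exact Prod.ext rfl ((segment_one c b).trans (segment_zero b a).symm)
    · exact Prod.ext rfl ((segment_one 0 a).trans (segment_one b a).symm)
  · refine (congrArg₂ (· ∪ ·) (range_sumElim_prodMap hf'') (range_sumElim_prodMap hf'')).trans ?_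
    rw [range_segment ha0, range_segment_of_gt hbc, range_segment_of_gt hab, range_segment hc1,
      ← prod_union, union_comm (Icc b c), union_comm (Icc c 1)]
    exact (congrArg (univ ×ˢ ·) (Icc_union_Icc_union_alternate a b c)).trans univ_prod_univ
  · refine (congrArg₂ (· ∩ ·) (range_sumElim_prodMap hf'') (range_sumElim_prodMap hf'')).le.trans ?_
    rw [range_segment ha0, range_segment_of_gt hbc, range_segment_of_gt hab, range_segment hc1,
      union_comm (Icc b c), union_comm (Icc c 1)]
    rintro ⟨s, t⟩ ⟨⟨_, h1⟩, ⟨_, h2⟩⟩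
    obtain ⟨x, rfl⟩ := hf'' s
    rcases Icc_union_Icc_inter_alternate hab hbc ⟨h1, h2⟩ with h | h | h
    · exact ⟨Sum.inr (Sum.inr x), Prod.ext rfl ((segment_one 0 a).trans h.symm)⟩
    · exact ⟨Sum.inr (Sum.inl x), Prod.ext rfl ((segment_one c b).trans h.symm)⟩
    · exact ⟨Sum.inl x, Prod.ext rfl ((segment_zero c b).trans h.symm)⟩
  · funext x
    rcases x with x | x
    · exact isEmptyElim x
    · exact Prod.ext rfl (segment_zero 0 a)
  · funext x
    rcases x with x | x
    · exact Prod.ext rfl (segment_one c 1)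
    · exact isEmptyElim x

end Zigzag

/-! ### Duality in the bordism category -/

section BordismDuality

open MonoidalCategory

variable {n : ℕ}

namespace Cob

theorem ofBordism_tensor {M N M' N' : Cob.{u} n} (B : Bordism M N) (B' : Bordism M' N') :
    tensorHom (ofBordism B) (ofBordism B') = ofBordism (B.sum B') :=
  Quotient.sound (.disjoint B B')

theorem ofBordism_comp {L M N : Cob.{u} n} {B : Bordism L M} {B' : Bordism M N} {C : Bordism L N}
    (h : B.IsGluing B' C) : ofBordism B ≫ ofBordism B' = ofBordism C :=
  Quotient.sound (.glue h)

/-- The coevaluation `∅ → M̄ ⊔ M`, given by the cylinder `M × [0, 1]`. -/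
noncomputable def coev (M : Cob.{u} n) : 𝟙_ (Cob.{u} n) ⟶ (M.opp : Cob.{u} n) ⊗ M :=
  ofBordism (.coevaluation M)

/-- The evaluation and coevaluation bordisms make `M̄` and `M` dual objects of `Cob(n)`. -/
noncomputable instance exactPairing (M : Cob.{u} n) : ExactPairing (M.opp : Cob.{u} n) M where
  coevaluation' := coev M
  evaluation' := ev M
  coevaluation_evaluation' := by
    change tensorHom (ofBordism (.mappingCylinder (.refl M))) (ofBordism (.coevaluation M)) ≫
      ofBordism (.mappingCylinder (OrientedDiffeo.sumAssoc M M.opp M).symm) ≫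
      tensorHom (ofBordism (.evaluation M)) (ofBordism (.mappingCylinder (.refl M))) =
      ofDiffeo (.sumEmpty M) ≫ ofDiffeo (OrientedDiffeo.emptySum M).symm
    -- The collar of the first factor absorbs the associator; the unitors are mapping cylinders too.
    have h := ((Bordism.isGluing_cylinder M).sum (Bordism.isGluing_coevaluation_cylinder M))
      |>.congr_right (Bordism.equivalent_cylinder_sum M (M.opp.sum M))
    rw [ofBordism_tensor, ofBordism_tensor, ← Category.assoc, ofBordism_comp (h.mapOut _),
      ofBordism_comp (Bordism.isGluing_zigzag M), ofDiffeo_comp]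
    rfl
  evaluation_coevaluation' := by
    change tensorHom (ofBordism (.coevaluation M)) (ofBordism (.mappingCylinder (.refl M.opp))) ≫
      ofBordism (.mappingCylinder (OrientedDiffeo.sumAssoc M.opp M M.opp)) ≫
      tensorHom (ofBordism (.mappingCylinder (.refl M.opp))) (ofBordism (.evaluation M)) =
      ofDiffeo (.emptySum M.opp) ≫ ofDiffeo (OrientedDiffeo.sumEmpty M.opp).symm
    have h := ((Bordism.isGluing_coevaluation_cylinder M).sum (Bordism.isGluing_cylinder M.opp))
      |>.congr_right (Bordism.equivalent_cylinder_sum (M.opp.sum M) M.opp)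
    rw [ofBordism_tensor, ofBordism_tensor, ← Category.assoc, ofBordism_comp (h.mapOut _),
      ofBordism_comp (Bordism.isGluing_zigzag_opp M), ofDiffeo_comp]
    rfl

end Cob

end BordismDuality

/-! ### Duality in linear algebra -/

section LinearDuality

open MonoidalCategory Functor.LaxMonoidal Functor.OplaxMonoidal TensorProduct


/-- Monoidal functors preserve dual objects. -/
@[reducible] def CategoryTheory.ExactPairing.map {C D : Type*} [Category C] [MonoidalCategory C]
    [Category D] [MonoidalCategory D] (F : C ⥤ D) [F.Monoidal] (X Y : C) [ExactPairing X Y] :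
    ExactPairing (F.obj X) (F.obj Y) where
  coevaluation' := ε F ≫ F.map (η_ X Y) ≫ δ F X Y
  evaluation' := μ F Y X ≫ F.map (ε_ X Y) ≫ η F
  coevaluation_evaluation' := by
    -- The triangle identity in `C` is inserted into the unit coherences of `F`.
    have h1 : (ρ_ (F.obj Y)).hom ≫ (λ_ (F.obj Y)).inv =
        (F.obj Y ◁ ε F) ≫ μ F Y (𝟙_ C) ≫ F.map ((ρ_ Y).hom ≫ (λ_ Y).inv) ≫
          δ F (𝟙_ C) Y ≫ (η F ▷ F.obj Y) := by simp
    rw [h1, ← ExactPairing.coevaluation_evaluation X Y]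
    simp only [Functor.map_comp, Functor.Monoidal.map_whiskerLeft,
      Functor.Monoidal.map_whiskerRight, Functor.Monoidal.map_associator_inv, Category.assoc,
      Functor.Monoidal.μ_δ_assoc, MonoidalCategory.whiskerLeft_comp, comp_whiskerRight]
  evaluation_coevaluation' := by
    have h1 : (λ_ (F.obj X)).hom ≫ (ρ_ (F.obj X)).inv =
        (ε F ▷ F.obj X) ≫ μ F (𝟙_ C) X ≫ F.map ((λ_ X).hom ≫ (ρ_ X).inv) ≫
          δ F X (𝟙_ C) ≫ (F.obj X ◁ η F) := by simp
    rw [h1, ← ExactPairing.evaluation_coevaluation X Y]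
    simp only [Functor.map_comp, Functor.Monoidal.map_whiskerLeft,
      Functor.Monoidal.map_whiskerRight, Functor.Monoidal.map_associator, Category.assoc,
      Functor.Monoidal.μ_δ_assoc, MonoidalCategory.whiskerLeft_comp, comp_whiskerRight]

variable {k : Type v} [Field k]

/-- If `x ↦ ∑ B(x, wᵢ) vᵢ` is the identity, then the finitely many `vᵢ` span. -/
theorem LinearMap.finiteDimensional_of_dual_families {V W : Type*} [AddCommGroup V] [Module k V]
    [AddCommGroup W] [Module k W] (B : V →ₗ[k] W →ₗ[k] k) {ι : Type*} (s : Finset ι) (w : ι → W)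
    (v : ι → V) (h : ∀ x, ∑ i ∈ s, B x (w i) • v i = x) : FiniteDimensional k V := by
  refine FiniteDimensional.of_surjective
    (∑ i : s, (LinearMap.proj i : (s → k) →ₗ[k] k).smulRight (v i)) fun x =>
      ⟨fun i => B x (w i), ?_⟩
  simp only [LinearMap.sum_apply, LinearMap.smulRight_apply, LinearMap.proj_apply]
  rw [Finset.sum_coe_sort s fun i => B x (w i) • v i, h]

/-- The first identity makes `V` finite-dimensional and the pairing nondegenerate in `V`; the second
one makes it nondegenerate in `W`. -/
theorem LinearMap.isPerfPair_of_dual_families {V W : Type*} [AddCommGroup V] [Module k V]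
    [AddCommGroup W] [Module k W] (B : V →ₗ[k] W →ₗ[k] k) {ι : Type*} (s : Finset ι) (w : ι → W)
    (v : ι → V) (h : ∀ x, ∑ i ∈ s, B x (w i) • v i = x)
    (h' : ∀ y, ∑ i ∈ s, B (v i) y • w i = y) : B.IsPerfPair := by
  have := B.finiteDimensional_of_dual_families s w v h
  refine .of_injective ((injective_iff_map_eq_zero B).mpr fun x hx => ?_)
    ((injective_iff_map_eq_zero B.flip).mpr fun y hy => ?_)
  · rw [← h x, hx]
    simp
  · rw [← h' y]
    refine Finset.sum_eq_zero fun i _ => ?_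
    rw [← LinearMap.flip_apply, hy]
    simp

/-- In the category of vector spaces, the coevaluation of a pair of dual objects is given by dual
families of vectors. -/
theorem ModuleCat.exists_dual_families (W V : ModuleCat.{v} k) [ExactPairing W V] :
    ∃ s : Finset (W × V),
      (∀ x : V, ∑ i ∈ s, (ε_ W V).hom (x ⊗ₜ i.1) • i.2 = x) ∧
      (∀ y : W, ∑ i ∈ s, (ε_ W V).hom (i.2 ⊗ₜ y) • i.1 = y) := by
  obtain ⟨s, hs⟩ := TensorProduct.exists_finset ((η_ W V).hom (1 : k))
  refine ⟨s, fun x => ?_, fun y => ?_⟩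
  -- Both sums are computed by evaluating a triangle identity at `x ⊗ 1`, respectively `1 ⊗ y`.
  · have h := congrArg (fun f => (λ_ V).hom.hom (f.hom (x ⊗ₜ (1 : k))))
      (ExactPairing.coevaluation_evaluation W V)
    simp only [ModuleCat.hom_comp, LinearMap.comp_apply] at h
    have h1 : (V ◁ η_ W V).hom (x ⊗ₜ (1 : k)) = ∑ i ∈ s, x ⊗ₜ[k] (i.1 ⊗ₜ[k] i.2) := by
      rw [← TensorProduct.tmul_sum, ← hs]
      rfl
    rw [h1, map_sum, map_sum, map_sum] at h
    refine h.trans ?_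
    exact ((λ_ V).inv_hom_id_apply _).trans (one_smul k x)
  · have h := congrArg (fun f => (ρ_ W).hom.hom (f.hom ((1 : k) ⊗ₜ y)))
      (ExactPairing.evaluation_coevaluation W V)
    simp only [ModuleCat.hom_comp, LinearMap.comp_apply] at h
    have h1 : (η_ W V ▷ W).hom ((1 : k) ⊗ₜ y) = ∑ i ∈ s, (i.1 ⊗ₜ[k] i.2) ⊗ₜ[k] y := by
      rw [← TensorProduct.sum_tmul, ← hs]
      rfl
    rw [h1, map_sum, map_sum, map_sum] at h
    refine h.trans ?_
    exact ((ρ_ W).inv_hom_id_apply _).trans (one_smul k y)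

end LinearDuality

/-- Let `Z : Cob(n) ⥤ Vect(k)` be an `(n + 1)`-dimensional topological quantum field theory and `M` a
closed oriented `n`-manifold. Then `Z(M)` is finite-dimensional, the pairing of `Z(M)` and `Z(M̄)`
given by the evaluation bordism `M × [0, 1] : M ⊔ M̄ → ∅` is perfect, and it identifies `Z(M̄)` with the
dual vector space of `Z(M)`. -/
theorem mainTheorem9 {n : ℕ} {k : Type v} [Field k] (Z : Cob.{u} n ⥤ ModuleCat.{v} k) [Z.Monoidal]
    (M : Cob.{u} n) :
    FiniteDimensional k (Z.obj M) ∧ (evaluationPairing Z M).IsPerfPair ∧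
      ∃ e : Z.obj M.opp ≃ₗ[k] Module.Dual k (Z.obj M),
        ∀ w x, e w x = evaluationPairing Z M x w := by
  -- The evaluation of the transported duality is by definition the uncurried `evaluationPairing`.
  let _ := CategoryTheory.ExactPairing.map Z (M.opp : Cob.{u} n) M
  obtain ⟨s, h, h'⟩ := ModuleCat.exists_dual_families (Z.obj M.opp) (Z.obj M)
  have hp : (evaluationPairing Z M).IsPerfPair :=
    LinearMap.isPerfPair_of_dual_families _ s Prod.fst Prod.snd h h'
  -- The equivalence is the flipped pairing, which is bijective because the pairing is perfect.
  exact ⟨LinearMap.finiteDimensional_of_dual_families (evaluationPairing Z M) s Prod.fst Prod.snd h,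
    hp, LinearEquiv.ofBijective _ hp.bijective_right, fun w x => rfl⟩
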